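/- Let $\mathbb H$ be the quaternions, $\mathbb S=\{I\in\mathbb H:\ \operatorname{Re} I=0,\ \|I\|=1\}$, and $\mathbb C_I=\{x+Iy:\ x,y\in\mathbb R\}$ for $I\in\mathbb S$; let $\overline{\mathbb H}$ and $\overline{\mathbb C_I}$ denote the one-point compactifications. A set $U\subseteq\mathbb H$ is axially symmetric if $x+Iy\in U$ with $x,y\in\mathbb R$, $I\in\mathbb S$ implies $x+Jy\in U$ for all $J\in\mathbb S$. A real differentiable function $f:U\to\mathbb H$ on an open set $U$ is slice regular if $\frac12\left(\frac{\partial}{\partial x}+I\frac{\partial}{\partial y}\right)f(x+Iy)=0$ for all $I\in\mathbb S$ and all $x+Iy\in U\cap\mathbb C_I$. A polynomial is a function $q\mapsto\sum_{k=0}^n q^k a_k$ with $a_k\in\mathbb H$. Let $\Sigma\subseteq\mathbb H$ be a bounded region (non-empty, open and connected) which is a Jordan region in the sense that, for every $I\in\mathbb S$, $\Sigma\cap\mathbb C_I$ is a domain of the plane $\mathbb C_I$ whose boundary in $\mathbb C_I$ is a Jordan curve. Suppose that $\Sigma$ is starlike with respect to some real point $x_0$ (for every $q\in\Sigma$ the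 segment from $x_0$ to $q$ lies in $\Sigma$), that $\overline\Sigma$ is axially symmetric, that $\overline{\mathbb H}\setminus\overline\Sigma$ is connected, and that $\overline{\mathbb C_I}\setminus(\overline\Sigma\cap\mathbb C_I)$ is connected for all $I\in\mathbb S$. Let $\alpha\in\overline\Sigma$, and let $f:\overline\Sigma\to\mathbb H$ be continuous on $\overline\Sigma$ and slice regular in $\Sigma$. Then for every $\varepsilon>0$ there is a polynomial $P$ with $\|f(q)-P(q)\|<\varepsilon$ for all $q\in\overline\Sigma$ and $P(\alpha)=f(\alpha)$. -/

import Mathlib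

/-!
On a single plane `ℂ_I` the function splits into holomorphic coordinates, for which a polynomial
approximation on `closure Ω ∩ ℂ_I` is a case of Mergelyan's theorem. Star-convexity makes it
elementary: after mollification and the Cauchy–Pompeiu formula, the Cauchy kernel with pole `p` is
replaced near the set by a second order approximation whose only singularities lie on a slit
leaving `p` away from the set, and slit functions are limits of polynomials because they are
holomorphic near the dilations of the set towards its centre. The Jordan curve hypothesis enters
through the fact that the slice of `Ω` is the whole interior of its closure.

The representation formula recovers a slice regular function from its restriction to one plane,
with a bound, so an approximation on one plane by a polynomial with right coefficients is an
approximation on `closure Ω`. As only `closure Ω` is axially symmetric, the slices of `Ω` may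
differ from each other; by Baire's theorem they are dense in the corresponding slice of `closure Ω`
for a dense set of `I`, and the formula extends to all `I` by continuity. Adding a constant to the
polynomial gives the interpolation at `α`.
-/

open scoped Quaternion

noncomputable section

/-- The unit sphere of purely imaginary quaternions. -/
def imagUnitSphere : Set ℍ[ℝ] := {I | I.re = 0 ∧ ‖I‖ = 1}

/-- The quaternion `x + I y`. -/
def slicePoint (I : ℍ[ℝ]) (x y : ℝ) : ℍ[ℝ] := (x : ℍ[ℝ]) + I * (y : ℍ[ℝ])

/-- The intersection `U ∩ ℂ_I`, where the plane `ℂ_I = {x + I y}` is identified with `ℂ`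
through `x + i y ↦ x + I y` (an isometry for `I` in the unit sphere of imaginary quaternions). -/
def sliceSet (U : Set ℍ[ℝ]) (I : ℍ[ℝ]) : Set ℂ := {z | slicePoint I z.re z.im ∈ U}

/-- Axial symmetry: with `x + I y` the set contains all `x + J y`. -/
def IsAxiallySymmetric (U : Set ℍ[ℝ]) : Prop :=
  ∀ x y : ℝ, ∀ I ∈ imagUnitSphere, slicePoint I x y ∈ U →
    ∀ J ∈ imagUnitSphere, slicePoint J x y ∈ U

/-- The Cauchy-Riemann operator `½ (∂/∂x + I ∂/∂y)` of the restriction of `f` to `ℂ_I`,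
at the point `x + I y`. -/
def sliceDbar (f : ℍ[ℝ] → ℍ[ℝ]) (I : ℍ[ℝ]) (x y : ℝ) : ℍ[ℝ] :=
  (1 / 2 : ℝ) • (deriv (fun s : ℝ => f (slicePoint I s y)) x
    + I * deriv (fun t : ℝ => f (slicePoint I x t)) y)

/-- Slice regularity on an open set `U`: `f` is real differentiable on `U` and
its restriction to every plane `ℂ_I` is annihilated by the Cauchy-Riemann operator. -/
def IsSliceRegularOn (f : ℍ[ℝ] → ℍ[ℝ]) (U : Set ℍ[ℝ]) : Prop :=
  DifferentiableOn ℝ f U ∧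
    ∀ I ∈ imagUnitSphere, ∀ x y : ℝ, slicePoint I x y ∈ U → sliceDbar f I x y = 0

/-- Polynomial functions `q ↦ ∑ q ^ k a_k`, with quaternionic coefficients on the right. -/
def IsRightPolynomial (P : ℍ[ℝ] → ℍ[ℝ]) : Prop :=
  ∃ (n : ℕ) (a : ℕ → ℍ[ℝ]), ∀ q, P q = ∑ k ∈ Finset.range (n + 1), q ^ k * a k

/-- A bounded Jordan region of the plane: a bounded domain whose boundary is a Jordan curve,
that is, the image of a continuous injective map of the circle. -/
def IsBoundedJordanRegion (G : Set ℂ) : Prop :=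
  IsOpen G ∧ IsConnected G ∧ Bornology.IsBounded G ∧
    ∃ γ : Circle → ℂ, Continuous γ ∧ Function.Injective γ ∧ Set.range γ = frontier G

/-- The complement of `K` in the one-point compactification of `X`. -/
def extendedCompl {X : Type*} (K : Set X) : Set (OnePoint X) := ((↑) '' K)ᶜ

end

/-- `F` is a uniform limit on `K` of complex polynomials. -/
def PolyApprox (K : Set ℂ) (F : ℂ → ℂ) : Prop :=
  ∀ ε : ℝ, 0 < ε → ∃ p : Polynomial ℂ, ∀ z ∈ K, ‖F z - p.eval z‖ < ε

namespace PolyApprox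

variable {K : Set ℂ} {F G : ℂ → ℂ}

theorem polynomial (p : Polynomial ℂ) : PolyApprox K fun z => p.eval z :=
  fun _ hε => ⟨p, fun _ _ => by simpa using hε⟩

theorem const (c : ℂ) : PolyApprox K fun _ => c := by
  simpa using polynomial (K := K) (Polynomial.C c)

theorem of_approx (h : ∀ ε : ℝ, 0 < ε → ∃ G, PolyApprox K G ∧ ∀ z ∈ K, ‖F z - G z‖ < ε) :
    PolyApprox K F := by
  intro ε hε
  obtain ⟨G, hG, hFG⟩ := h (ε / 2) (by positivity)
  obtain ⟨p, hp⟩ := hG (ε / 2) (by positivity)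
  refine ⟨p, fun z hz => ?_⟩
  linarith [norm_sub_le_norm_sub_add_norm_sub (F z) (G z) (p.eval z), hFG z hz, hp z hz]

theorem congr (hG : PolyApprox K G) (h : ∀ z ∈ K, F z = G z) : PolyApprox K F :=
  of_approx fun ε hε => ⟨G, hG, fun z hz => by simpa [h z hz] using hε⟩

theorem add (hF : PolyApprox K F) (hG : PolyApprox K G) : PolyApprox K fun z => F z + G z := by
  intro ε hε
  obtain ⟨p, hp⟩ := hF (ε / 2) (by positivity)
  obtain ⟨q, hq⟩ := hG (ε / 2) (by positivity)
  refine ⟨p + q, fun z hz => ?_⟩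
  rw [Polynomial.eval_add, add_sub_add_comm]
  linarith [norm_add_le (F z - p.eval z) (G z - q.eval z), hp z hz, hq z hz]

theorem sum {ι : Type*} (s : Finset ι) {F : ι → ℂ → ℂ} (h : ∀ i ∈ s, PolyApprox K (F i)) :
    PolyApprox K fun z => ∑ i ∈ s, F i z := by
  classical
  induction s using Finset.induction_on with
  | empty => simpa using const (K := K) 0
  | insert a s ha ih =>
    simp only [Finset.sum_insert ha]
    exact (h a (by simp)).add (ih fun i hi => h i (by simp [hi]))

theorem mul_polynomial (hK : IsCompact K) (hF : PolyApprox K F) (q : Polynomial ℂ) :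
    PolyApprox K fun z => F z * q.eval z := by
  intro ε hε
  obtain ⟨C, hC⟩ := hK.exists_bound_of_continuousOn (f := fun z => q.eval z)
    q.continuous.continuousOn
  obtain ⟨p, hp⟩ := hF (ε / (|C| + 1)) (by positivity)
  refine ⟨p * q, fun z hz => ?_⟩
  rw [Polynomial.eval_mul, ← sub_mul, norm_mul]
  calc ‖F z - p.eval z‖ * ‖q.eval z‖ ≤ ‖F z - p.eval z‖ * (|C| + 1) := by
        gcongr; linarith [hC z hz, le_abs_self C]
    _ < ε / (|C| + 1) * (|C| + 1) := by gcongr; exact hp z hz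
    _ = ε := by field_simp

theorem comp_polynomial {L : Set ℂ} (hF : PolyApprox K F) (q : Polynomial ℂ)
    (hq : ∀ z ∈ L, q.eval z ∈ K) : PolyApprox L fun z => F (q.eval z) := by
  intro ε hε
  obtain ⟨p, hp⟩ := hF ε hε
  exact ⟨p.comp q, fun z hz => by simpa using hp _ (hq z hz)⟩

end PolyApprox

section Taylor

variable {E : Type*} [NormedAddCommGroup E] [NormedSpace ℂ E] [CompleteSpace E] {F : ℂ → E}

theorem differentiableOn_iteratedDeriv {U : Set ℂ} (hF : DifferentiableOn ℂ F U)
    (hU : IsOpen U) (n : ℕ) : DifferentiableOn ℂ (iteratedDeriv n F) U := by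
  induction n with
  | zero => simpa using hF
  | succ n ih => rw [iteratedDeriv_succ]; exact ih.deriv hU

theorem norm_taylorTerm_le {c w : ℂ} {r M : ℝ} (hr : 0 < r)
    (hF : DiffContOnCl ℂ F (Metric.ball c r)) (hM : ∀ y ∈ Metric.sphere c r, ‖F y‖ ≤ M) (n : ℕ) :
    ‖(n.factorial : ℂ)⁻¹ • w ^ n • iteratedDeriv n F c‖ ≤ M * (‖w‖ / r) ^ n := by
  have cauchy := Complex.norm_iteratedDeriv_le_of_forall_mem_sphere_norm_le n hr hF hM
  have hfac : (n.factorial : ℝ) ≠ 0 := by positivity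
  simp only [norm_smul, norm_inv, norm_pow, Complex.norm_natCast]
  calc (n.factorial : ℝ)⁻¹ * (‖w‖ ^ n * ‖iteratedDeriv n F c‖)
      ≤ (n.factorial : ℝ)⁻¹ * (‖w‖ ^ n * (n.factorial * M / r ^ n)) := by gcongr
    _ = M * (‖w‖ / r) ^ n := by rw [div_pow]; field_simp

theorem tendstoUniformlyOn_taylor {K : Set ℂ} {c w : ℂ → ℂ} {r M : ℝ} (hr : 0 < r)
    (hF : ∀ z ∈ K, DiffContOnCl ℂ F (Metric.ball (c z) r))
    (hM : ∀ z ∈ K, ∀ y ∈ Metric.sphere (c z) r, ‖F y‖ ≤ M) (hw : ∀ z ∈ K, ‖w z‖ ≤ r / 2) :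
    TendstoUniformlyOn
      (fun N z => ∑ n ∈ Finset.range N, (n.factorial : ℂ)⁻¹ • w z ^ n • iteratedDeriv n F (c z))
      (fun z => F (c z + w z)) Filter.atTop K := by
  have hsum : ∀ z ∈ K,
      ∑' n, (n.factorial : ℂ)⁻¹ • w z ^ n • iteratedDeriv n F (c z) = F (c z + w z) := by
    intro z hz
    have hmem : c z + w z ∈ Metric.ball (c z) r := by
      simpa using (hw z hz).trans_lt (half_lt_self hr)
    simpa using (Complex.hasSum_taylorSeries_on_ball (hF z hz).differentiableOn hmem).tsum_eq
  have hbd : ∀ n, ∀ z ∈ K,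
      ‖(n.factorial : ℂ)⁻¹ • w z ^ n • iteratedDeriv n F (c z)‖ ≤ |M| * (1 / 2) ^ n := by
    intro n z hz
    have hMz := fun y hy => (hM z hz y hy).trans (le_abs_self M)
    have hratio : ‖w z‖ / r ≤ 1 / 2 := by rw [div_le_iff₀ hr]; linarith [hw z hz]
    exact (norm_taylorTerm_le hr (hF z hz) hMz n).trans (by gcongr)
  exact (tendstoUniformlyOn_tsum_nat (summable_geometric_two.mul_left |M|) hbd).congr_right hsum

end Taylor

theorem PolyApprox.comp_add_polynomial {K U : Set ℂ} (hK : IsCompact K) (hU : IsOpen U) {r : ℝ}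
    (hr : 0 < r) (hrU : Metric.cthickening r K ⊆ U) {c : ℂ → ℂ} (hc : Set.MapsTo c K K)
    {q : Polynomial ℂ} (hq : ∀ z ∈ K, ‖q.eval z‖ ≤ r / 2)
    (h : ∀ F : ℂ → ℂ, DifferentiableOn ℂ F U → PolyApprox K fun z => F (c z))
    {F : ℂ → ℂ} (hF : DifferentiableOn ℂ F U) : PolyApprox K fun z => F (c z + q.eval z) := by
  obtain ⟨M, hM⟩ := hK.cthickening.exists_bound_of_continuousOn (hF.continuousOn.mono hrU)
  have hball : ∀ z ∈ K, Metric.closedBall (c z) r ⊆ Metric.cthickening r K := fun z hz =>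
    Metric.closedBall_subset_cthickening (hc hz) r
  have htaylor : TendstoUniformlyOn
      (fun N z => ∑ n ∈ Finset.range N,
        (n.factorial : ℂ)⁻¹ • (q.eval z) ^ n • iteratedDeriv n F (c z))
      (fun z => F (c z + q.eval z)) Filter.atTop K :=
    tendstoUniformlyOn_taylor hr
      (fun z hz => (hF.mono (Metric.closure_ball_subset_closedBall.trans
        ((hball z hz).trans hrU))).diffContOnCl)
      (fun z hz y hy => hM y (hball z hz (Metric.sphere_subset_closedBall hy))) hq
  refine PolyApprox.of_approx fun ε hε => ?_
  obtain ⟨N, hN⟩ := (Metric.tendstoUniformlyOn_iff.1 htaylor ε hε).exists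
  refine ⟨fun z => ∑ n ∈ Finset.range N,
    (n.factorial : ℂ)⁻¹ • (q.eval z) ^ n • iteratedDeriv n F (c z),
    PolyApprox.sum _ fun n _ => ?_, fun z hz => ?_⟩
  · refine ((h _ (differentiableOn_iteratedDeriv hF hU n)).mul_polynomial hK
      (Polynomial.C (n.factorial : ℂ)⁻¹ * q ^ n)).congr fun z _ => ?_
    simp only [smul_eq_mul, Polynomial.eval_mul, Polynomial.eval_pow, Polynomial.eval_C]
    ring
  · simpa only [dist_eq_norm] using hN z hz

-- `F 0` is pushed to `F z` along the dilations `z ↦ (k / N) z`, one Taylor expansion per step.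
theorem PolyApprox.of_differentiableOn_of_starConvex {K U : Set ℂ} (hK : IsCompact K)
    (hU : IsOpen U) (hKU : K ⊆ U) (hstar : StarConvex ℝ 0 K) {F : ℂ → ℂ}
    (hF : DifferentiableOn ℂ F U) : PolyApprox K F := by
  obtain ⟨r, hr, hrU⟩ := hK.exists_cthickening_subset_open hU hKU
  obtain ⟨R, hR0, hR⟩ := hK.isBounded.exists_pos_norm_le
  obtain ⟨N, hN⟩ := exists_nat_gt (2 * R / r)
  have hN0 : 0 < (N : ℝ) := lt_of_le_of_lt (by positivity) hN
  have dilation : ∀ k : ℕ, k ≤ N → ∀ F : ℂ → ℂ, DifferentiableOn ℂ F U →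
      PolyApprox K fun z => F ((k / N : ℝ) * z) := by
    intro k
    induction k with
    | zero => intro _ F _; simpa using PolyApprox.const (K := K) (F 0)
    | succ k ih =>
      intro hk F hF
      have hmaps : Set.MapsTo (fun z : ℂ => ((k / N : ℝ) : ℂ) * z) K K := fun z hz => by
        have hkN : (k / N : ℝ) ≤ 1 := by
          rw [div_le_one hN0]; exact_mod_cast (by omega : k ≤ N)
        simpa using starConvex_zero_iff.1 hstar hz (by positivity) hkN
      have hsmall : ∀ z ∈ K, ‖(Polynomial.C (1 / N : ℂ) * Polynomial.X).eval z‖ ≤ r / 2 := by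
        intro z hz
        have : ‖z‖ ≤ N * (r / 2) := by rw [div_lt_iff₀ hr] at hN; linarith [hR z hz]
        simpa [inv_mul_le_iff₀ hN0] using this
      refine (PolyApprox.comp_add_polynomial hK hU hr hrU hmaps hsmall
        (ih (by omega)) hF).congr fun z _ => congrArg F ?_
      simp only [Polynomial.eval_mul, Polynomial.eval_C, Polynomial.eval_X]
      push_cast
      ring
  simpa [hN0.ne'] using dilation N le_rfl F hF

section SlitKernel

/-- The inverse of the Joukowski map `h ↦ (h + h⁻¹) / 2` that maps the complement of `[-1, 1]`
into the unit disc. -/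
noncomputable def slitInv (s : ℂ) : ℂ := s * (1 - (1 - 1 / s ^ 2) ^ (2 : ℂ)⁻¹)

/-- The real segment `[-1, 1]` in the complex plane. -/
def unitSlit : Set ℂ := (fun t : ℝ => (t : ℂ)) '' Set.Icc (-1) 1

theorem isClosed_unitSlit : IsClosed unitSlit :=
  (isCompact_Icc.image Complex.continuous_ofReal).isClosed

section

variable {s : ℂ}

theorem ne_zero_of_notMem_unitSlit (hs : s ∉ unitSlit) : s ≠ 0 := by
  rintro rfl
  exact hs ⟨0, by simp, by simp⟩

theorem one_sub_mem_slitPlane (hs : s ∉ unitSlit) : 1 - 1 / s ^ 2 ∈ Complex.slitPlane := by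
  rw [Complex.mem_slitPlane_iff_not_le_zero]
  intro h
  apply hs
  obtain ⟨hre, him⟩ := Complex.le_def.1 h
  set r : ℝ := (1 / s ^ 2).re with hr
  have inv_eq : 1 / s ^ 2 = (r : ℂ) :=
    Complex.ext (by rw [hr, Complex.ofReal_re]) (by simpa using him)
  have one_le : 1 ≤ r := by
    rw [inv_eq] at hre
    simpa using hre
  have sq_eq : s ^ 2 = ((√(1 / r) : ℝ) : ℂ) ^ 2 := by
    rw [← Complex.ofReal_pow, Real.sq_sqrt (by positivity), Complex.ofReal_div, ← inv_eq]
    simp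
  have sqrt_le : √(1 / r) ≤ 1 := by
    rwa [Real.sqrt_le_one, div_le_one (by linarith)]
  have sqrt_nonneg := Real.sqrt_nonneg (1 / r)
  rcases sq_eq_sq_iff_eq_or_eq_neg.1 sq_eq with h | h
  · exact ⟨√(1 / r), ⟨by linarith, sqrt_le⟩, h.symm⟩
  · exact ⟨-√(1 / r), ⟨by linarith, by linarith⟩, by simp [h]⟩

theorem slitInv_sq_add_one (hs : s ∉ unitSlit) : slitInv s ^ 2 + 1 = 2 * s * slitInv s := by
  have hs0 := ne_zero_of_notMem_unitSlit hs
  have hw := Complex.cpow_ofNat_inv_pow (1 - 1 / s ^ 2) 2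
  rw [slitInv]
  set w := (1 - 1 / s ^ 2) ^ (2 : ℂ)⁻¹
  have : s ^ 2 * w ^ 2 = s ^ 2 - 1 := by rw [hw]; field_simp
  linear_combination this

theorem re_cpow_two_inv_nonneg (w : ℂ) : 0 ≤ (w ^ (2 : ℂ)⁻¹).re := by
  rcases eq_or_ne w 0 with rfl | hw
  · simp
  have him : (Complex.log w * (2 : ℂ)⁻¹).im = w.arg / 2 := by
    rw [show (2 : ℂ)⁻¹ = ((2⁻¹ : ℝ) : ℂ) by push_cast; rfl, Complex.im_mul_ofReal, Complex.log_im]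
    ring
  rw [Complex.cpow_def_of_ne_zero hw, Complex.exp_re, him]
  refine mul_nonneg (Real.exp_pos _).le (Real.cos_nonneg_of_mem_Icc ⟨?_, ?_⟩)
  · linarith [Complex.neg_pi_lt_arg w]
  · linarith [Complex.arg_le_pi w]

theorem norm_one_sub_le_norm_one_add {w : ℂ} (hw : 0 ≤ w.re) : ‖1 - w‖ ≤ ‖1 + w‖ := by
  rw [← sq_le_sq₀ (norm_nonneg _) (norm_nonneg _), ← Complex.normSq_eq_norm_sq,
    ← Complex.normSq_eq_norm_sq, Complex.normSq_apply, Complex.normSq_apply]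
  simp only [Complex.sub_re, Complex.sub_im, Complex.add_re, Complex.add_im, Complex.one_re,
    Complex.one_im]
  nlinarith

theorem norm_slitInv_le_one (hs : s ∉ unitSlit) : ‖slitInv s‖ ≤ 1 := by
  have hs0 := ne_zero_of_notMem_unitSlit hs
  have hw := Complex.cpow_ofNat_inv_pow (1 - 1 / s ^ 2) 2
  have hre := re_cpow_two_inv_nonneg (1 - 1 / s ^ 2)
  rw [slitInv]
  set w := (1 - 1 / s ^ 2) ^ (2 : ℂ)⁻¹
  have hle : ‖s * (1 - w)‖ ≤ ‖s * (1 + w)‖ := by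
    rw [norm_mul, norm_mul]
    gcongr
    exact norm_one_sub_le_norm_one_add hre
  have hprod : s * (1 - w) * (s * (1 + w)) = 1 := by
    have : s ^ 2 * w ^ 2 = s ^ 2 - 1 := by rw [hw]; field_simp
    linear_combination -this
  have hnorm := congrArg norm hprod
  rw [norm_mul, norm_one] at hnorm
  nlinarith [norm_nonneg (s * (1 - w))]

theorem differentiableAt_slitInv (hs : s ∉ unitSlit) : DifferentiableAt ℂ slitInv s := by
  have hs0 := ne_zero_of_notMem_unitSlit hs
  have hinv : DifferentiableAt ℂ (fun s : ℂ => 1 - 1 / s ^ 2) s :=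
    (differentiableAt_const _).sub
      ((differentiableAt_const _).div (by fun_prop) (by simpa using hs0))
  exact differentiableAt_id.mul ((differentiableAt_const _).sub
    (hinv.cpow (by fun_prop) (one_sub_mem_slitPlane hs)))

theorem norm_slitInv_mul_le (hs : s ∉ unitSlit) : ‖slitInv s‖ * ‖s‖ ≤ 1 := by
  have h := congrArg norm (slitInv_sq_add_one hs)
  have hle : ‖slitInv s ^ 2 + 1‖ ≤ 1 + 1 := by
    refine (norm_add_le _ _).trans ?_
    rw [norm_pow, norm_one]
    gcongr
    exact pow_le_one₀ (norm_nonneg _) (norm_slitInv_le_one hs)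
  rw [norm_mul, norm_mul, Complex.norm_ofNat] at h
  linarith

end

/-- A function holomorphic off the segment `[m - d, m + d]`, bounded by `2 / ‖d‖` and close to
`1 / (z - m)` at infinity. -/
noncomputable def slitKernel (m d z : ℂ) : ℂ := 2 / d * slitInv ((z - m) / d)

/-- Mergelyan's substitute for the Cauchy kernel `1 / (z - ζ)`. It is the expansion
`1 / (z - m) + (ζ - m) / (z - m) ^ 2` of the latter with `1 / (z - m)` replaced by the bounded
function `slitKernel m d`. -/
noncomputable def mergelyanKernel (m d ζ z : ℂ) : ℂ :=
  slitKernel m d z + (ζ - m) * slitKernel m d z ^ 2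

/-- Up to a constant, the majorant of the difference of the Cauchy kernel and `mergelyanKernel` as
a function of the distance `r = ‖z - ζ‖`; it is integrable in the plane. -/
noncomputable def kernelMajorant (δ r : ℝ) : ℝ := δ ^ 2 / (r * (δ ^ 2 + r ^ 2))

variable {m d z ζ : ℂ}

theorem differentiableAt_slitKernel (hz : (z - m) / d ∉ unitSlit) :
    DifferentiableAt ℂ (slitKernel m d) z :=
  (differentiableAt_const _).mul
    (DifferentiableAt.comp (g := slitInv) z (differentiableAt_slitInv hz) (by fun_prop))

theorem norm_slitKernel_le (hz : (z - m) / d ∉ unitSlit) : ‖slitKernel m d z‖ ≤ 2 / ‖d‖ := by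
  rw [slitKernel, norm_mul, norm_div, Complex.norm_ofNat]
  exact mul_le_of_le_one_right (by positivity) (norm_slitInv_le_one hz)

theorem norm_slitKernel_mul_le (hd : d ≠ 0) (hz : (z - m) / d ∉ unitSlit) :
    ‖slitKernel m d z‖ * ‖z - m‖ ≤ 2 := by
  have h := norm_slitInv_mul_le hz
  have hd' : ‖d‖ ≠ 0 := norm_ne_zero_iff.2 hd
  rw [norm_div] at h
  rw [slitKernel, norm_mul, norm_div, Complex.norm_ofNat]
  calc 2 / ‖d‖ * ‖slitInv ((z - m) / d)‖ * ‖z - m‖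
      = 2 * (‖slitInv ((z - m) / d)‖ * (‖z - m‖ / ‖d‖)) := by field_simp
    _ ≤ 2 := by linarith

theorem norm_slitKernel_sub_mul_le (hd : d ≠ 0) (hz : (z - m) / d ∉ unitSlit) :
    ‖slitKernel m d z - 1 / (z - m)‖ * ‖z - m‖ ^ 3 ≤ ‖d‖ ^ 2 := by
  have hv : z - m ≠ 0 := fun h => ne_zero_of_notMem_unitSlit hz (by simp [h])
  have hquad := slitInv_sq_add_one hz
  have hle := norm_slitInv_mul_le hz
  unfold slitKernel
  set w := slitInv ((z - m) / d)
  have hfactor : (2 / d * w - 1 / (z - m)) * (z - m) ^ 3 = d ^ 2 * (w * ((z - m) / d)) ^ 2 := by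
    field_simp
    field_simp at hquad
    linear_combination -hquad
  rw [← norm_pow, ← norm_mul, hfactor, norm_mul, norm_pow, norm_pow, norm_mul]
  exact mul_le_of_le_one_right (by positivity) (pow_le_one₀ (by positivity) hle)

theorem norm_mergelyanKernel_sub_le_of_near (hd : d ≠ 0) (hz : (z - m) / d ∉ unitSlit)
    (hζ : ‖ζ - m‖ ≤ 5 * ‖d‖) (hne : z ≠ ζ) (hnear : ‖z - ζ‖ ≤ 10 * ‖d‖) :
    ‖mergelyanKernel m d ζ z - 1 / (z - ζ)‖ ≤ 30000 * kernelMajorant ‖d‖ ‖z - ζ‖ := by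
  have hδ : 0 < ‖d‖ := norm_pos_iff.2 hd
  have hr : 0 < ‖z - ζ‖ := norm_pos_iff.2 (sub_ne_zero.2 hne)
  have hg := norm_slitKernel_le hz
  rw [mergelyanKernel, kernelMajorant]
  set g := slitKernel m d z
  set δ := ‖d‖
  set r := ‖z - ζ‖
  have hbound : ‖g + (ζ - m) * g ^ 2 - 1 / (z - ζ)‖ ≤ 22 / δ + 1 / r := by
    refine (norm_sub_le _ _).trans ?_
    rw [norm_div, norm_one]
    gcongr
    refine (norm_add_le _ _).trans ?_
    rw [norm_mul, norm_pow]
    calc ‖g‖ + ‖ζ - m‖ * ‖g‖ ^ 2 ≤ 2 / δ + 5 * δ * (2 / δ) ^ 2 := by gcongr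
      _ = 22 / δ := by field_simp; norm_num
  rw [← mul_div_assoc, le_div_iff₀ (by positivity)]
  calc ‖g + (ζ - m) * g ^ 2 - 1 / (z - ζ)‖ * (r * (δ ^ 2 + r ^ 2))
      ≤ (22 / δ + 1 / r) * (r * (δ ^ 2 + r ^ 2)) := by gcongr
    _ = (22 * (r / δ) + 1) * (δ ^ 2 + r ^ 2) := by field_simp
    _ ≤ (22 * 10 + 1) * (δ ^ 2 + (10 * δ) ^ 2) := by
        gcongr; rwa [div_le_iff₀ hδ]
    _ ≤ 30000 * δ ^ 2 := by nlinarith [sq_nonneg δ]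

theorem norm_mergelyanKernel_sub_le_cubes (hd : d ≠ 0) (hz : (z - m) / d ∉ unitSlit)
    (hζ : ‖ζ - m‖ ≤ 5 * ‖d‖) (hne : z ≠ ζ) :
    ‖mergelyanKernel m d ζ z - 1 / (z - ζ)‖ ≤ ‖d‖ ^ 2 / ‖z - m‖ ^ 3
      + 5 * ‖d‖ * (‖d‖ ^ 2 / ‖z - m‖ ^ 3 * (3 / ‖z - m‖))
      + (5 * ‖d‖) ^ 2 / (‖z - m‖ ^ 2 * ‖z - ζ‖) := by
  have hu0 : z - ζ ≠ 0 := sub_ne_zero.2 hne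
  have hv0 : z - m ≠ 0 := fun h => ne_zero_of_notMem_unitSlit hz (by simp [h])
  have hR : 0 < ‖z - m‖ := norm_pos_iff.2 hv0
  have hgR := norm_slitKernel_mul_le hd hz
  have hgsub := norm_slitKernel_sub_mul_le hd hz
  rw [mergelyanKernel]
  set g := slitKernel m d z
  have hsplit : g + (ζ - m) * g ^ 2 - 1 / (z - ζ) = (g - 1 / (z - m))
      + (ζ - m) * ((g - 1 / (z - m)) * (g + 1 / (z - m)))
      - (ζ - m) ^ 2 / ((z - m) ^ 2 * (z - ζ)) := by
    field_simp
    ring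
  have hsub : ‖g - 1 / (z - m)‖ ≤ ‖d‖ ^ 2 / ‖z - m‖ ^ 3 := by rwa [le_div_iff₀ (by positivity)]
  have hadd : ‖g + 1 / (z - m)‖ ≤ 3 / ‖z - m‖ := by
    refine (norm_add_le _ _).trans ?_
    rw [norm_div, norm_one]
    have : ‖g‖ ≤ 2 / ‖z - m‖ := by rwa [le_div_iff₀ hR]
    calc ‖g‖ + 1 / ‖z - m‖ ≤ 2 / ‖z - m‖ + 1 / ‖z - m‖ := by gcongr
      _ = 3 / ‖z - m‖ := by ring
  rw [hsplit]
  refine (norm_sub_le _ _).trans (add_le_add ((norm_add_le _ _).trans ?_) ?_)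
  · rw [norm_mul, norm_mul]; gcongr
  · rw [norm_div, norm_mul, norm_pow, norm_pow]; gcongr

theorem norm_mergelyanKernel_sub_le_of_far (hd : d ≠ 0) (hz : (z - m) / d ∉ unitSlit)
    (hζ : ‖ζ - m‖ ≤ 5 * ‖d‖) (hfar : 10 * ‖d‖ ≤ ‖z - ζ‖) :
    ‖mergelyanKernel m d ζ z - 1 / (z - ζ)‖ ≤ 30000 * kernelMajorant ‖d‖ ‖z - ζ‖ := by
  have hδ : 0 < ‖d‖ := norm_pos_iff.2 hd
  have hr : 0 < ‖z - ζ‖ := by linarith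
  have hbound := norm_mergelyanKernel_sub_le_cubes hd hz hζ (sub_ne_zero.1 (norm_pos_iff.1 hr))
  have hR : ‖z - ζ‖ / 2 ≤ ‖z - m‖ := by
    have := norm_sub_le (z - m) (ζ - m)
    rw [sub_sub_sub_cancel_right] at this
    linarith
  rw [kernelMajorant]
  set δ := ‖d‖
  set r := ‖z - ζ‖
  set R := ‖z - m‖
  have hcubic : δ ^ 2 / R ^ 3 + 5 * δ * (δ ^ 2 / R ^ 3 * (3 / R)) + (5 * δ) ^ 2 / (R ^ 2 * r)
      ≤ 200 * δ ^ 2 / r ^ 3 := by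
    calc δ ^ 2 / R ^ 3 + 5 * δ * (δ ^ 2 / R ^ 3 * (3 / R)) + (5 * δ) ^ 2 / (R ^ 2 * r)
        ≤ δ ^ 2 / (r / 2) ^ 3 + 5 * δ * (δ ^ 2 / (r / 2) ^ 3 * (3 / (r / 2)))
          + (5 * δ) ^ 2 / ((r / 2) ^ 2 * r) := by gcongr
      _ = (108 + 240 * (δ / r)) * δ ^ 2 / r ^ 3 := by field_simp; ring
      _ ≤ 200 * δ ^ 2 / r ^ 3 := by
        gcongr
        have : δ / r ≤ 1 / 10 := by rw [div_le_iff₀ hr]; linarith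
        linarith
  refine (hbound.trans hcubic).trans ?_
  rw [← mul_div_assoc, div_le_div_iff₀ (by positivity) (by positivity)]
  calc 200 * δ ^ 2 * (r * (δ ^ 2 + r ^ 2)) ≤ 200 * δ ^ 2 * (r * (r ^ 2 + r ^ 2)) := by
        gcongr; linarith
    _ ≤ 30000 * δ ^ 2 * r ^ 3 := by nlinarith [show 0 ≤ δ ^ 2 * r ^ 3 by positivity]

theorem norm_mergelyanKernel_sub_le (hd : d ≠ 0) (hz : (z - m) / d ∉ unitSlit)
    (hζ : ‖ζ - m‖ ≤ 5 * ‖d‖) (hne : z ≠ ζ) :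
    ‖mergelyanKernel m d ζ z - 1 / (z - ζ)‖ ≤ 30000 * kernelMajorant ‖d‖ ‖z - ζ‖ :=
  (le_total ‖z - ζ‖ (10 * ‖d‖)).elim (norm_mergelyanKernel_sub_le_of_near hd hz hζ hne)
    (norm_mergelyanKernel_sub_le_of_far hd hz hζ)

end SlitKernel

section CauchyPompeiu

open MeasureTheory Set Real

variable {E : Type*} [NormedAddCommGroup E]

theorem integrableOn_polarCoord_target {G : ℝ × ℝ → E} (hG : Continuous G) {R : ℝ}
    (hR : ∀ p : ℝ × ℝ, R < p.1 → G p = 0) :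
    IntegrableOn G (Ioi 0 ×ˢ Ioo (-π) π) (volume.prod volume) := by
  have h : IntegrableOn G (Icc 0 R ×ˢ Icc (-π) π) (volume.prod volume) :=
    hG.continuousOn.integrableOn_compact (isCompact_Icc.prod isCompact_Icc)
  refine h.of_forall_sdiff_eq_zero (measurableSet_Ioi.prod measurableSet_Ioo) ?_
  rintro ⟨r, θ⟩ ⟨⟨hr, hθ⟩, hn⟩
  refine hR _ ?_
  by_contra hle
  exact hn ⟨⟨le_of_lt hr, not_lt.1 hle⟩, Ioo_subset_Icc_self hθ⟩

variable [NormedSpace ℝ E]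

theorem integral_eq_setIntegral_polar {g : ℂ → E} {G : ℝ × ℝ → E}
    (hgG : ∀ r θ : ℝ, 0 < r → r • g (circleMap 0 r θ) = G (r, θ)) :
    ∫ z, g z = ∫ p in Ioi 0 ×ˢ Ioo (-π) π, G p ∂(volume.prod volume) := by
  rw [← Complex.integral_comp_polarCoord_symm, ← Measure.volume_eq_prod]
  refine setIntegral_congr_fun (measurableSet_Ioi.prod measurableSet_Ioo) ?_
  rintro ⟨r, θ⟩ ⟨hr, -⟩
  have : circleMap 0 r θ = Complex.polarCoord.symm (r, θ) := by
    simp [circleMap_zero, Complex.exp_mul_I]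
  simp only [← this, hgG r θ hr]

theorem integral_Ioo_fderiv_circleMap_tangent [CompleteSpace E] {Φ : ℂ → E}
    (hΦ : ContDiff ℝ 1 Φ) {r : ℝ} (hr : r ≠ 0) :
    ∫ θ in Ioo (-π) π, fderiv ℝ Φ (circleMap 0 r θ) (Complex.I * circleMap 0 1 θ) = 0 := by
  have hderiv : ∀ θ, HasDerivAt (fun θ => Φ (circleMap 0 r θ))
      (r • fderiv ℝ Φ (circleMap 0 r θ) (Complex.I * circleMap 0 1 θ)) θ := by
    intro θ
    have h := ((hΦ.differentiable one_ne_zero _).hasFDerivAt).comp_hasDerivAt θ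
      (hasDerivAt_circleMap 0 r θ)
    refine h.congr_deriv ?_
    rw [← map_smul]
    congr 1
    simp only [circleMap_zero, Complex.real_smul, Complex.ofReal_one]
    ring
  have hcont : Continuous fun θ =>
      r • fderiv ℝ Φ (circleMap 0 r θ) (Complex.I * circleMap 0 1 θ) :=
    (((hΦ.continuous_fderiv one_ne_zero).comp (continuous_circleMap 0 r)).clm_apply
      (continuous_const.mul (continuous_circleMap 0 1))).const_smul r
  have hint := intervalIntegral.integral_eq_sub_of_hasDerivAt (fun θ _ => hderiv θ)
    (hcont.intervalIntegrable (-π) π)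
  have hends : circleMap 0 r π = circleMap 0 r (-π) := by
    rw [← periodic_circleMap 0 r (-π)]
    ring_nf
  rw [hends, sub_self, intervalIntegral.integral_smul, intervalIntegral.integral_of_le
    (by linarith [pi_pos]), integral_Ioc_eq_integral_Ioo] at hint
  exact (smul_eq_zero.1 hint).resolve_left hr

theorem integral_Ioi_fderiv_circleMap_radial [CompleteSpace E] {Φ : ℂ → E}
    (hΦ : ContDiff ℝ 1 Φ) (hc : HasCompactSupport Φ) (θ : ℝ) :
    ∫ r in Ioi 0, fderiv ℝ Φ (circleMap 0 r θ) (circleMap 0 1 θ) = -Φ 0 := by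
  let ray : ℝ →L[ℝ] ℂ := Complex.ofRealCLM.smulRight (circleMap 0 1 θ)
  have hray : ∀ r : ℝ, ray r = circleMap 0 r θ := fun r => by
    simp [ray, circleMap_zero]
  have hderiv : ∀ r : ℝ, deriv (fun r => Φ (ray r)) r
      = fderiv ℝ Φ (circleMap 0 r θ) (circleMap 0 1 θ) := fun r => by
    have h := ((hΦ.differentiable one_ne_zero (ray r)).hasFDerivAt).comp_hasDerivAt r
      ray.hasDerivAt
    rw [← hray, show circleMap 0 1 θ = ray 1 by rw [hray]]
    exact h.deriv
  have hnorm : ∀ r, ‖ray r‖ = ‖r‖ := fun r => by simp [hray]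
  have hemb : Topology.IsClosedEmbedding ray :=
    (AddMonoidHomClass.isometry_of_norm ray hnorm).isClosedEmbedding
  simpa only [Function.comp_def, hderiv, map_zero] using
    (hc.comp_isClosedEmbedding hemb).integral_Ioi_deriv_eq (hΦ.comp ray.contDiff) 0

/-- The operator `∂/∂x + i ∂/∂y`, twice the Wirtinger derivative with respect to `conj z`. -/
noncomputable def dbar (Φ : ℂ → ℂ) (z : ℂ) : ℂ :=
  fderiv ℝ Φ z 1 + Complex.I * fderiv ℝ Φ z Complex.I

theorem apply_add_I_mul_apply_I_mul (L : ℂ →L[ℝ] ℂ) (u : ℂ) :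
    L u + Complex.I * L (Complex.I * u)
      = (starRingEnd ℂ) u * (L 1 + Complex.I * L Complex.I) := by
  have hL : ∀ a b : ℝ, L (a + b * Complex.I) = a * L 1 + b * L Complex.I := by
    intro a b
    have : (a + b * Complex.I : ℂ) = a • (1 : ℂ) + b • Complex.I := by simp
    rw [this, map_add, map_smul, map_smul, Complex.real_smul, Complex.real_smul]
  obtain ⟨a, b⟩ := u
  rw [Complex.mk_eq_add_mul_I, hL, show Complex.I * (a + b * Complex.I)
    = ((-b : ℝ) : ℂ) + a * Complex.I by push_cast; linear_combination b * Complex.I_mul_I, hL]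
  simp only [map_add, map_mul, Complex.conj_ofReal, Complex.conj_I]
  push_cast
  linear_combination b * L Complex.I * Complex.I_mul_I

theorem smul_dbar_div_circleMap (Φ : ℂ → ℂ) {r : ℝ} (hr : r ≠ 0) (θ : ℝ) :
    r • (dbar Φ (circleMap 0 r θ) / circleMap 0 r θ)
      = fderiv ℝ Φ (circleMap 0 r θ) (circleMap 0 1 θ)
        + Complex.I * fderiv ℝ Φ (circleMap 0 r θ) (Complex.I * circleMap 0 1 θ) := by
  have hr' : (r : ℂ) ≠ 0 := by exact_mod_cast hr
  have hinv : (circleMap 0 1 θ)⁻¹ = (starRingEnd ℂ) (circleMap 0 1 θ) := by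
    rw [Complex.inv_def, Complex.normSq_eq_norm_sq, norm_circleMap_zero]
    simp
  have hcircle : circleMap 0 r θ = r * circleMap 0 1 θ := by simp [circleMap_zero]
  rw [apply_add_I_mul_apply_I_mul, ← hinv, Complex.real_smul, dbar]
  generalize fderiv ℝ Φ (circleMap 0 r θ) = L
  rw [hcircle]
  field_simp

theorem integral_dbar_div {Φ : ℂ → ℂ} (hΦ : ContDiff ℝ 1 Φ) (hc : HasCompactSupport Φ) :
    ∫ z, dbar Φ z / z = -(2 * π) * Φ 0 := by
  obtain ⟨R, hR⟩ := hc.isCompact.isBounded.subset_closedBall 0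
  set radial : ℝ × ℝ → ℂ := fun p => fderiv ℝ Φ (circleMap 0 p.1 p.2) (circleMap 0 1 p.2)
  set angular : ℝ × ℝ → ℂ := fun p =>
    fderiv ℝ Φ (circleMap 0 p.1 p.2) (Complex.I * circleMap 0 1 p.2)
  have hvanish : ∀ p : ℝ × ℝ, |R| < p.1 → fderiv ℝ Φ (circleMap 0 p.1 p.2) = 0 := by
    refine fun p hp => by_contra fun h => ?_
    have := hR (support_fderiv_subset ℝ h)
    rw [mem_closedBall_zero_iff, norm_circleMap_zero] at this
    linarith [le_abs_self R, le_abs_self p.1]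
  have hcircle : ∀ f : ℝ × ℝ → ℝ, Continuous f → Continuous fun p => circleMap 0 (f p) p.2 := by
    intro f hf
    simp only [circleMap_zero]
    fun_prop
  have hfderiv : Continuous fun p : ℝ × ℝ => fderiv ℝ Φ (circleMap 0 p.1 p.2) :=
    (hΦ.continuous_fderiv one_ne_zero).comp (hcircle _ continuous_fst)
  have hradial : IntegrableOn radial (Ioi 0 ×ˢ Ioo (-π) π) (volume.prod volume) :=
    integrableOn_polarCoord_target (R := |R|) (hfderiv.clm_apply (hcircle _ continuous_const))
      (fun p hp => by simp [radial, hvanish p hp])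
  have hangular : IntegrableOn angular (Ioi 0 ×ˢ Ioo (-π) π) (volume.prod volume) :=
    integrableOn_polarCoord_target (R := |R|)
      (hfderiv.clm_apply (continuous_const.mul (hcircle _ continuous_const)))
      (fun p hp => by simp [angular, hvanish p hp])
  rw [integral_eq_setIntegral_polar (G := fun p => radial p + Complex.I * angular p)
    fun r θ hr => smul_dbar_div_circleMap Φ hr.ne' θ,
    integral_add hradial (hangular.const_mul _), integral_const_mul,
    setIntegral_prod _ hangular, setIntegral_prod _ hradial,
    integral_integral_swap (f := fun r θ => radial (r, θ))
      (by rw [Measure.prod_restrict]; exact hradial)]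
  have hangular_zero : ∀ r ∈ Ioi (0 : ℝ), ∫ θ in Ioo (-π) π, angular (r, θ) = 0 := fun r hr =>
    integral_Ioo_fderiv_circleMap_tangent hΦ (ne_of_gt hr)
  rw [setIntegral_eq_zero_of_forall_eq_zero hangular_zero]
  simp only [radial, integral_Ioi_fderiv_circleMap_radial hΦ hc, integral_const,
    measureReal_restrict_apply_univ, Real.volume_real_Ioo_of_le (by linarith [pi_pos] : -π ≤ π),
    Complex.real_smul]
  push_cast
  ring

theorem dbar_comp_const_add (Φ : ℂ → ℂ) (a z : ℂ) :
    dbar (fun w => Φ (a + w)) z = dbar Φ (a + z) := by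
  rw [dbar, dbar, fderiv_comp_add_left]

theorem integral_dbar_mul_cauchyKernel {Φ : ℂ → ℂ} (hΦ : ContDiff ℝ 1 Φ)
    (hc : HasCompactSupport Φ) (z : ℂ) :
    ∫ ζ, dbar Φ ζ * (1 / (z - ζ)) = 2 * π * Φ z := by
  have h := integral_dbar_div (Φ := fun w => Φ (z + w)) (hΦ.comp (contDiff_const.add contDiff_id))
    (hc.comp_homeomorph (Homeomorph.addLeft z))
  simp only [dbar_comp_const_add, add_zero] at h
  rw [← integral_add_left_eq_self _ z, ← neg_inj, ← neg_mul, ← h, ← integral_neg]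
  congr 1 with w
  rw [sub_add_cancel_left, div_neg, mul_neg, neg_neg, mul_one_div]

end CauchyPompeiu

section Mollification

open MeasureTheory Set Real Metric Convolution

/-- A radial smooth bump supported in the closed unit disc. -/
noncomputable def radialBump (z : ℂ) : ℝ := Real.smoothTransition (1 - ‖z‖ ^ 2)

theorem contDiff_radialBump : ContDiff ℝ 1 radialBump :=
  Real.smoothTransition.contDiff.comp (contDiff_const.sub (contDiff_norm_sq ℝ))

theorem support_radialBump_subset : Function.support radialBump ⊆ ball 0 1 := by
  intro z hz
  rw [mem_ball_zero_iff]
  by_contra! h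
  exact hz (Real.smoothTransition.zero_of_nonpos (by nlinarith))

theorem integral_radialBump_pos : 0 < ∫ z, radialBump z :=
  contDiff_radialBump.continuous.integral_pos_of_hasCompactSupport_nonneg_nonzero
    (.of_support_subset_isCompact (isCompact_closedBall 0 1)
      (support_radialBump_subset.trans ball_subset_closedBall))
    (fun _ => Real.smoothTransition.nonneg _) (x := 0) (by simp [radialBump])

/-- The rescaling of `radialBump` of integral `1` supported in the disc of radius `δ`. -/
noncomputable def mollifier (δ : ℝ) (z : ℂ) : ℝ :=
  ((∫ w, radialBump w)⁻¹ * δ⁻¹ ^ 2) * radialBump (δ⁻¹ • z)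

theorem mollifier_congr_norm (δ : ℝ) {z w : ℂ} (h : ‖z‖ = ‖w‖) :
    mollifier δ z = mollifier δ w := by
  simp only [mollifier, radialBump, norm_smul, h]

theorem mollifier_nonneg (δ : ℝ) (z : ℂ) : 0 ≤ mollifier δ z :=
  mul_nonneg (mul_nonneg (inv_nonneg.2 integral_radialBump_pos.le) (sq_nonneg _))
    (Real.smoothTransition.nonneg _)

theorem contDiff_mollifier (δ : ℝ) : ContDiff ℝ 1 (mollifier δ) :=
  contDiff_const.mul (contDiff_radialBump.comp (contDiff_const_smul _))

section

variable {δ : ℝ}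

theorem support_mollifier_subset (hδ : 0 < δ) : Function.support (mollifier δ) ⊆ ball 0 δ := by
  intro z hz
  have h := support_radialBump_subset (right_ne_zero_of_mul hz)
  rw [mem_ball_zero_iff, norm_smul, norm_inv, Real.norm_of_nonneg hδ.le, inv_mul_lt_iff₀ hδ,
    mul_one] at h
  rwa [mem_ball_zero_iff]

theorem hasCompactSupport_mollifier (hδ : 0 < δ) : HasCompactSupport (mollifier δ) :=
  .of_support_subset_isCompact (isCompact_closedBall 0 δ)
    ((support_mollifier_subset hδ).trans ball_subset_closedBall)

theorem integral_mollifier (hδ : 0 < δ) : ∫ z, mollifier δ z = 1 := by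
  have hpos := integral_radialBump_pos
  simp only [mollifier]
  rw [integral_const_mul, Measure.integral_comp_smul, Complex.finrank_real_complex,
    abs_of_nonneg (by positivity), smul_eq_mul]
  field_simp

end

/-- The integral of `‖fderiv ℝ (mollifier δ)‖` for `δ = 1`; it is
`mollifierConst / δ` in general. -/
noncomputable def mollifierConst : ℝ :=
  (∫ z, radialBump z)⁻¹ * ∫ z, ‖fderiv ℝ radialBump z‖

theorem mollifierConst_nonneg : 0 ≤ mollifierConst :=
  mul_nonneg (inv_nonneg.2 integral_radialBump_pos.le) (integral_nonneg fun _ => norm_nonneg _)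

theorem integral_norm_fderiv_mollifier {δ : ℝ} (hδ : 0 < δ) :
    ∫ z, ‖fderiv ℝ (mollifier δ) z‖ = mollifierConst / δ := by
  have hpos := integral_radialBump_pos
  have hbump : ContDiff ℝ 1 fun z : ℂ => radialBump (δ⁻¹ • z) :=
    contDiff_radialBump.comp (contDiff_const_smul _)
  have hfderiv : ∀ z, ‖fderiv ℝ (mollifier δ) z‖
      = ((∫ z, radialBump z)⁻¹ * δ⁻¹ ^ 3) * ‖fderiv ℝ radialBump (δ⁻¹ • z)‖ := by
    intro z
    unfold mollifier
    rw [fderiv_const_mul (hbump.differentiable one_ne_zero z), fderiv_comp_smul, norm_smul,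
      norm_smul, Real.norm_of_nonneg (by positivity), Real.norm_of_nonneg (by positivity)]
    ring
  simp only [hfderiv]
  rw [integral_const_mul, Measure.integral_comp_smul volume (fun z => ‖fderiv ℝ radialBump z‖),
    Complex.finrank_real_complex, abs_of_nonneg (by positivity), smul_eq_mul, mollifierConst]
  field_simp

section RadialAverage

variable {E : Type*} [NormedAddCommGroup E] [NormedSpace ℂ E] [CompleteSpace E]

theorem integral_Ioo_circleMap {f : ℂ → E} {c : ℂ} {r : ℝ}
    (hf : DiffContOnCl ℂ f (ball c |r|)) :
    ∫ θ in Ioo (-π) π, f (circleMap c r θ) = (2 * π) • f c := by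
  have h := hf.circleAverage
  rw [Real.circleAverage_eq_integral_add (-π),
    intervalIntegral.integral_comp_add_right (fun θ => f (circleMap c r θ)), zero_add,
    show 2 * π + -π = π by ring, intervalIntegral.integral_of_le (by linarith [pi_pos]),
    integral_Ioc_eq_integral_Ioo] at h
  rw [← h, smul_inv_smul₀ (by positivity)]

theorem integral_radial_smul_eq_integral_Ioi {A : ℂ → ℝ} {δ : ℝ} (hA : Continuous A)
    (hsupp : Function.support A ⊆ ball 0 δ) (hrad : ∀ z w, ‖z‖ = ‖w‖ → A z = A w) {f : ℂ → E}
    (hf : Continuous f) {z : ℂ} (hfd : DifferentiableOn ℂ f (ball z δ)) :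
    ∫ w, A w • f (z - w) = ∫ r in Ioi (0 : ℝ), (r * A r) • (2 * π) • f z := by
  have hA0 : ∀ w, δ ≤ ‖w‖ → A w = 0 := fun w hw => by
    by_contra h
    exact (mem_ball_zero_iff.1 (hsupp h)).not_ge hw
  have : Continuous fun p : ℝ × ℝ => circleMap 0 p.1 p.2 := by
    simp only [circleMap_zero]
    fun_prop
  rw [integral_eq_setIntegral_polar (G := fun p => p.1 • A (circleMap 0 p.1 p.2) •
    f (z - circleMap 0 p.1 p.2)) fun _ _ _ => rfl, setIntegral_prod]
  · refine setIntegral_congr_fun measurableSet_Ioi fun r (hr : 0 < r) => ?_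
    have hAr : ∀ θ, A (circleMap 0 r θ) = A r := fun θ => hrad _ _ (by simp)
    simp only [hAr, integral_smul, mul_smul r]
    rcases le_or_gt δ r with hδr | hrδ
    · rw [hA0 r (by simpa [abs_of_pos hr] using hδr), zero_smul, zero_smul]
    · have hreflect : ∀ θ, z - circleMap 0 r θ = circleMap z (-r) θ := fun θ => by
        simp [circleMap, sub_eq_add_neg]
      simp only [hreflect]
      have hclosure : closure (ball z |-r|) ⊆ ball z δ := by
        rw [abs_neg, abs_of_pos hr]
        exact closure_ball_subset_closedBall.trans (closedBall_subset_ball hrδ)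
      rw [integral_Ioo_circleMap (hfd.mono hclosure).diffContOnCl]
  · refine integrableOn_polarCoord_target (R := |δ|) (by fun_prop) fun p hp => ?_
    rw [hA0, zero_smul, smul_zero]
    rw [norm_circleMap_zero]
    linarith [le_abs_self δ, le_abs_self p.1]

theorem integral_radial_smul {A : ℂ → ℝ} {δ : ℝ} (hA : Continuous A)
    (hsupp : Function.support A ⊆ ball 0 δ) (hrad : ∀ z w, ‖z‖ = ‖w‖ → A z = A w) {f : ℂ → E}
    (hf : Continuous f) {z : ℂ} (hfd : DifferentiableOn ℂ f (ball z δ)) :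
    ∫ w, A w • f (z - w) = (∫ w, A w) • f z := by
  rw [integral_radial_smul_eq_integral_Ioi hA hsupp hrad hf hfd, ← integral_smul_const]
  exact (integral_radial_smul_eq_integral_Ioi (z := z) hA hsupp hrad continuous_const
    (differentiableOn_const (f z))).symm

end RadialAverage

section ConvolutionDerivative

variable {E : Type*} [NormedAddCommGroup E] [NormedSpace ℝ E] [CompleteSpace E]
  {G : Type*} [NormedAddCommGroup G] [NormedSpace ℝ G] [FiniteDimensional ℝ G]
  [MeasurableSpace G] [BorelSpace G]
  {μ : Measure G} [μ.IsAddHaarMeasure] {A : G → ℝ}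

theorem integral_precompL_fderiv_eq_zero (hA : ContDiff ℝ 1 A) (hAc : HasCompactSupport A)
    (v : E) : ∫ t, (ContinuousLinearMap.lsmul ℝ ℝ).precompL G (fderiv ℝ A t) v ∂μ = 0 := by
  have hconst :
      (A ⋆[ContinuousLinearMap.lsmul ℝ ℝ, μ] fun _ => v) = fun _ => (∫ t, A t ∂μ) • v := by
    funext x
    simp only [convolution_def, ContinuousLinearMap.lsmul_apply, integral_smul_const]
  have h := hAc.hasFDerivAt_convolution_left (ContinuousLinearMap.lsmul ℝ ℝ) hA
    (μ := μ) (continuous_const (y := v)).locallyIntegrable 0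
  rw [hconst] at h
  exact h.unique (hasFDerivAt_const _ _)

theorem norm_fderiv_convolution_le (hA : ContDiff ℝ 1 A) (hAc : HasCompactSupport A) {f : G → E}
    (hf : Continuous f) {z : G} {R ε : ℝ} (hsupp : tsupport A ⊆ ball 0 R) (hε : 0 ≤ ε)
    (hfz : ∀ x ∈ ball z R, dist (f x) (f z) ≤ ε) :
    ‖fderiv ℝ (A ⋆[ContinuousLinearMap.lsmul ℝ ℝ, μ] f) z‖ ≤ (∫ t, ‖fderiv ℝ A t‖ ∂μ) * ε := by
  rw [(hAc.hasFDerivAt_convolution_left (ContinuousLinearMap.lsmul ℝ ℝ) hA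
    hf.locallyIntegrable z).fderiv]
  have h := dist_convolution_le' (μ := μ)
    ((ContinuousLinearMap.lsmul ℝ ℝ : ℝ →L[ℝ] E →L[ℝ] E).precompL G) hε
    ((hA.continuous_fderiv one_ne_zero).integrable_of_hasCompactSupport (hAc.fderiv ℝ))
    ((support_fderiv_subset ℝ).trans hsupp) hf.aestronglyMeasurable hfz
  rw [integral_precompL_fderiv_eq_zero hA hAc, dist_zero_right] at h
  refine h.trans ?_
  gcongr
  refine mul_le_of_le_one_left (integral_nonneg fun _ => norm_nonneg _) ?_
  exact (ContinuousLinearMap.norm_precompL_le _ _).trans ContinuousLinearMap.opNorm_lsmul_le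

end ConvolutionDerivative

theorem dbar_eq_zero_of_differentiableAt {f : ℂ → ℂ} {z : ℂ} (hf : DifferentiableAt ℂ f z) :
    dbar f z = 0 := by
  have h := (differentiableAt_complex_iff_differentiableAt_real.1 hf).2
  rw [dbar, h, smul_eq_mul]
  linear_combination (fderiv ℝ f z 1) * Complex.I_mul_I

theorem norm_dbar_le (Φ : ℂ → ℂ) (z : ℂ) : ‖dbar Φ z‖ ≤ 2 * ‖fderiv ℝ Φ z‖ := by
  have h1 := (fderiv ℝ Φ z).le_opNorm 1
  have hI := (fderiv ℝ Φ z).le_opNorm Complex.I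
  rw [norm_one] at h1
  rw [Complex.norm_I] at hI
  refine (norm_add_le _ _).trans ?_
  rw [norm_mul, Complex.norm_I]
  linarith

/-- The convolution of `f` with `mollifier δ`. -/
noncomputable def mollify (δ : ℝ) (f : ℂ → ℂ) : ℂ → ℂ :=
  mollifier δ ⋆[ContinuousLinearMap.lsmul ℝ ℝ, volume] f

section Mollify

variable {δ ε : ℝ} {f : ℂ → ℂ} {z : ℂ}

theorem hasCompactSupport_mollify (hδ : 0 < δ) (hfc : HasCompactSupport f) :
    HasCompactSupport (mollify δ f) :=
  (hasCompactSupport_mollifier hδ).convolution _ hfc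

theorem contDiff_mollify (hδ : 0 < δ) (hf : Continuous f) : ContDiff ℝ 1 (mollify δ f) :=
  (hasCompactSupport_mollifier hδ).contDiff_convolution_left _ (contDiff_mollifier δ)
    hf.locallyIntegrable

theorem norm_mollify_sub_le (hδ : 0 < δ) (hf : Continuous f) (hε : 0 ≤ ε)
    (hfz : ∀ x ∈ ball z δ, dist (f x) (f z) ≤ ε) :
    ‖mollify δ f z - f z‖ ≤ ε := by
  rw [← dist_eq_norm]
  exact dist_convolution_le hε (support_mollifier_subset hδ) (mollifier_nonneg δ)
    (integral_mollifier hδ) hf.aestronglyMeasurable hfz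

theorem norm_dbar_mollify_le (hδ : 0 < δ) (hf : Continuous f) (hε : 0 ≤ ε)
    (hfz : ∀ x ∈ ball z (2 * δ), dist (f x) (f z) ≤ ε) :
    ‖dbar (mollify δ f) z‖ ≤ 2 * (mollifierConst / δ * ε) := by
  have hsupp : tsupport (mollifier δ) ⊆ ball 0 (2 * δ) :=
    (closure_minimal ((support_mollifier_subset hδ).trans ball_subset_closedBall)
      isClosed_closedBall).trans (closedBall_subset_ball (by linarith))
  rw [← integral_norm_fderiv_mollifier hδ]
  refine (norm_dbar_le _ z).trans ?_
  gcongr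
  exact norm_fderiv_convolution_le (contDiff_mollifier δ) (hasCompactSupport_mollifier hδ) hf
    hsupp hε hfz

theorem dbar_mollify_eq_zero (hδ : 0 < δ) (hf : Continuous f)
    (hfd : DifferentiableOn ℂ f (ball z (2 * δ))) :
    dbar (mollify δ f) z = 0 := by
  have heq : mollify δ f =ᶠ[nhds z] f := by
    filter_upwards [ball_mem_nhds z hδ] with x hx
    have hsub : ball x δ ⊆ ball z (2 * δ) :=
      ball_subset_ball' (by linarith [mem_ball.1 hx])
    have h := integral_radial_smul (contDiff_mollifier δ).continuous (support_mollifier_subset hδ)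
      (fun _ _ => mollifier_congr_norm δ) hf (hfd.mono hsub)
    rwa [integral_mollifier hδ, one_smul] at h
  have hfz : DifferentiableAt ℂ f z :=
    (hfd z (mem_ball_self (by linarith))).differentiableAt (ball_mem_nhds _ (by linarith))
  have hzero := dbar_eq_zero_of_differentiableAt hfz
  rwa [dbar, ← heq.fderiv_eq] at hzero

end Mollify

end Mollification

section Mergelyan

open MeasureTheory Set Real Metric

theorem kernelMajorant_nonneg (δ : ℝ) {r : ℝ} (hr : 0 ≤ r) : 0 ≤ kernelMajorant δ r := by
  unfold kernelMajorant
  positivity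

theorem mul_kernelMajorant {δ r : ℝ} (hδ : 0 < δ) (hr : 0 < r) :
    r * kernelMajorant δ r = (1 + (δ⁻¹ * r) ^ 2)⁻¹ := by
  unfold kernelMajorant
  field_simp

theorem integrable_kernelMajorant {δ : ℝ} (hδ : 0 < δ) :
    Integrable fun u : ℂ => kernelMajorant δ ‖u‖ := by
  rw [integrable_fun_norm_addHaar, Complex.finrank_real_complex]
  refine (integrable_inv_one_add_sq.comp_mul_left' (inv_ne_zero hδ.ne')).integrableOn.congr_fun
    (fun r (hr : 0 < r) => ?_) measurableSet_Ioi
  rw [smul_eq_mul, pow_one, mul_kernelMajorant hδ hr]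

theorem integral_kernelMajorant {δ : ℝ} (hδ : 0 < δ) :
    ∫ u : ℂ, kernelMajorant δ ‖u‖ = π ^ 2 * δ := by
  have hradial : ∫ r in Ioi (0 : ℝ), r ^ (2 - 1) • kernelMajorant δ r = δ * (π / 2) := by
    calc _ = ∫ r in Ioi (0 : ℝ), (1 + (δ⁻¹ * r) ^ 2)⁻¹ :=
          setIntegral_congr_fun measurableSet_Ioi fun r (hr : 0 < r) => by
            rw [smul_eq_mul, pow_one, mul_kernelMajorant hδ hr]
      _ = δ * (π / 2) := by
        rw [integral_comp_mul_left_Ioi (fun r => (1 + r ^ 2)⁻¹) 0 (inv_pos.2 hδ), mul_zero,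
          integral_Ioi_inv_one_add_sq, arctan_zero, sub_zero, inv_inv, smul_eq_mul]
  rw [integral_fun_norm_addHaar volume (kernelMajorant δ), Complex.finrank_real_complex, hradial,
    measureReal_def, Complex.volume_ball]
  simp only [ENNReal.ofReal_one, one_pow, one_mul, ENNReal.coe_toReal, NNReal.coe_real_pi,
    smul_eq_mul, nsmul_eq_mul, Nat.cast_ofNat]
  ring

theorem continuous_dbar {Φ : ℂ → ℂ} (hΦ : ContDiff ℝ 1 Φ) : Continuous (dbar Φ) := by
  have := hΦ.continuous_fderiv one_ne_zero
  unfold dbar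
  fun_prop

theorem hasCompactSupport_dbar {Φ : ℂ → ℂ} (hc : HasCompactSupport Φ) :
    HasCompactSupport (dbar Φ) :=
  (hc.fderiv ℝ).mono fun z hz h => hz (by simp [dbar, h])

theorem exists_hasCompactSupport_eqOn {X : Type*} [TopologicalSpace X] [T4Space X]
    [LocallyCompactSpace X] {K : Set X} (hK : IsCompact K) {F : X → ℂ} (hF : ContinuousOn F K) :
    ∃ f : X → ℂ, Continuous f ∧ HasCompactSupport f ∧ EqOn f F K := by
  obtain ⟨g, hg⟩ := ContinuousMap.exists_restrict_eq hK.isClosed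
    (⟨K.domRestrict F, hF.domRestrict⟩ : C(K, ℂ))
  obtain ⟨φ, hφ, -, hφc, -⟩ :=
    exists_continuous_one_zero_of_isCompact hK isClosed_empty (disjoint_empty K)
  refine ⟨fun x => φ x • g x, by fun_prop, hφc.smul_right, fun x hx => ?_⟩
  have hgx : g x = F x := congrArg (fun ψ : C(K, ℂ) => ψ ⟨x, hx⟩) hg
  simp only [hφ hx, hgx, Pi.one_apply, one_smul]

theorem exists_simpleFunc_dist_lt {X : Type*} [PseudoMetricSpace X] [MeasurableSpace X]
    [OpensMeasurableSpace X] {T E : Set X} {ρ : ℝ} (hT : IsCompact T) (hE : E.Nonempty)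
    (hTE : ∀ x ∈ T, ∃ e ∈ E, dist x e < ρ) :
    ∃ N : SimpleFunc X X, (∀ x, N x ∈ E) ∧ ∀ x ∈ T, dist x (N x) < ρ := by
  obtain ⟨t, htE, htfin, ht⟩ := hT.elim_finite_subcover_image (b := E)
    (c := fun e => ball e ρ) (fun _ _ => isOpen_ball) fun x hx => by simpa using hTE x hx
  obtain ⟨e₀, he₀⟩ := hE
  obtain ⟨e, he⟩ := (htfin.insert e₀).countable.exists_eq_range (insert_nonempty e₀ t)
  have heE : ∀ n, e n ∈ E := fun n =>
    insert_subset he₀ htE (he ▸ mem_range_self n)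
  choose! k hk using fun p (hp : p ∈ t) => (he ▸ mem_insert_of_mem e₀ hp : p ∈ range e)
  obtain ⟨n, hn⟩ := (htfin.image k).bddAbove
  refine ⟨SimpleFunc.nearestPt e n, fun x => heE _, fun x hx => ?_⟩
  obtain ⟨p, hpt, hxp⟩ := mem_iUnion₂.1 (ht hx)
  have hnear := SimpleFunc.edist_nearestPt_le e x (hn (mem_image_of_mem k hpt))
  rw [hk p hpt, edist_dist, edist_dist, ENNReal.ofReal_le_ofReal_iff dist_nonneg, dist_comm,
    dist_comm p] at hnear
  exact hnear.trans_lt hxp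

/-- The complement of `K` is reachable by slits of length `2 δ`: every point outside `K` is within
distance `δ` of the midpoint `m` of a segment `[m - d, m + d]` with `‖d‖ = δ` that avoids `K`. -/
def SegmentAccessible (K : Set ℂ) (δ : ℝ) : Prop :=
  ∀ p ∉ K, ∃ m d : ℂ, ‖d‖ = δ ∧ ‖p - m‖ ≤ δ ∧ ∀ z ∈ K, (z - m) / d ∉ unitSlit

theorem segmentAccessible_of_starConvex {K : Set ℂ} (hK : StarConvex ℝ 0 K) {δ : ℝ}
    (hδ : 0 < δ) : SegmentAccessible K δ := by
  intro p hp
  rw [starConvex_zero_iff] at hK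
  rcases eq_or_ne p 0 with rfl | hp0
  · refine ⟨0, δ, by simp [abs_of_pos hδ], by simpa using hδ.le, fun z hz => ?_⟩
    exact (hp (by simpa using hK hz le_rfl zero_le_one)).elim
  have hpn : 0 < ‖p‖ := norm_pos_iff.2 hp0
  set c : ℝ := δ / ‖p‖
  have hc0 : 0 < c := by positivity
  have hcp : ‖c * p‖ = δ := by
    rw [norm_mul, Complex.norm_real, Real.norm_of_nonneg hc0.le, div_mul_cancel₀ _ hpn.ne']
  refine ⟨p + c * p, c * p, hcp, by simpa using hcp.le, ?_⟩
  rintro z hz ⟨t, ⟨ht, -⟩, htz⟩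
  have hzp : z = ((1 + (1 + t) * c : ℝ) : ℂ) * p := by
    rw [eq_div_iff (mul_ne_zero (by exact_mod_cast hc0.ne') hp0)] at htz
    push_cast
    linear_combination -htz
  have hscale : 1 ≤ 1 + (1 + t) * c := by nlinarith
  have hmem := hK hz (inv_nonneg.2 (zero_le_one.trans hscale)) (inv_le_one_of_one_le₀ hscale)
  rw [hzp, ← Complex.real_smul, inv_smul_smul₀ (by positivity)] at hmem
  exact hp hmem

theorem exists_simpleFunc_slit {K T : Set ℂ} {δ ρ : ℝ} (hK : K ≠ univ)
    (hacc : SegmentAccessible K δ) (hT : IsCompact T) (hTK : ∀ ζ ∈ T, ∃ p ∈ Kᶜ, dist ζ p < ρ) :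
    ∃ S : SimpleFunc ℂ (ℂ × ℂ), (∀ ζ, ‖(S ζ).2‖ = δ) ∧
      (∀ ζ, ∀ z ∈ K, (z - (S ζ).1) / (S ζ).2 ∉ unitSlit) ∧ ∀ ζ ∈ T, ‖ζ - (S ζ).1‖ ≤ ρ + δ := by
  choose! m d hd hm hslit using hacc
  obtain ⟨N, hNK, hN⟩ := exists_simpleFunc_dist_lt hT (nonempty_compl.2 hK) hTK
  refine ⟨N.map fun p => (m p, d p), fun ζ => hd _ (hNK ζ), fun ζ => hslit _ (hNK ζ),
    fun ζ hζ => ?_⟩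
  calc ‖ζ - m (N ζ)‖ ≤ ‖ζ - N ζ‖ + ‖N ζ - m (N ζ)‖ := norm_sub_le_norm_sub_add_norm_sub _ _ _
    _ ≤ ρ + δ := add_le_add (dist_eq_norm ζ (N ζ) ▸ (hN ζ hζ).le) (hm _ (hNK ζ))

section SlitCauchy

variable {K : Set ℂ} {S : SimpleFunc ℂ (ℂ × ℂ)} {ψ : ℂ → ℂ}

/-- The Cauchy transform `z ↦ (2π)⁻¹ ∫ ψ ζ / (z - ζ)` with the Cauchy kernel replaced by
`mergelyanKernel m d`, where `S ζ = (m, d)` is the slit chosen for `ζ`. -/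
noncomputable def slitCauchy (S : ℂ → ℂ × ℂ) (ψ : ℂ → ℂ) (z : ℂ) : ℂ :=
  (2 * π : ℂ)⁻¹ * ∫ ζ, ψ ζ * mergelyanKernel (S ζ).1 (S ζ).2 ζ z

theorem mul_mergelyanKernel_eq_sum (S : SimpleFunc ℂ (ℂ × ℂ)) (ψ : ℂ → ℂ) (ζ z : ℂ) :
    ψ ζ * mergelyanKernel (S ζ).1 (S ζ).2 ζ z = ∑ s ∈ S.range,
      ((S ⁻¹' {s}).indicator ψ ζ * slitKernel s.1 s.2 z
        + (S ⁻¹' {s}).indicator (fun ζ => ψ ζ * (ζ - s.1)) ζ * slitKernel s.1 s.2 z ^ 2) := by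
  rw [Finset.sum_eq_single (S ζ)]
  · simp only [mergelyanKernel, mem_preimage, mem_singleton_iff, indicator_of_mem]
    ring
  · intro s _ hs
    have hζ : ζ ∉ S ⁻¹' {s} := fun h => hs h.symm
    simp only [indicator_of_notMem hζ, zero_mul, add_zero]
  · exact fun h => absurd (S.mem_range_self ζ) h

section

variable (S)

theorem integrable_indicator_mul_slitKernel (hψ : Continuous ψ) (hψc : HasCompactSupport ψ)
    (s : ℂ × ℂ) (z : ℂ) :
    Integrable fun ζ => (S ⁻¹' {s}).indicator ψ ζ * slitKernel s.1 s.2 z :=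
  ((hψ.integrable_of_hasCompactSupport hψc).indicator (S.measurableSet_fiber s)).mul_const _

theorem integrable_indicator_mul_sub_mul_slitKernel_sq (hψ : Continuous ψ)
    (hψc : HasCompactSupport ψ) (s : ℂ × ℂ) (z : ℂ) :
    Integrable fun ζ =>
      (S ⁻¹' {s}).indicator (fun ζ => ψ ζ * (ζ - s.1)) ζ * slitKernel s.1 s.2 z ^ 2 :=
  ((Continuous.integrable_of_hasCompactSupport (by fun_prop) hψc.mul_right).indicator
    (S.measurableSet_fiber s)).mul_const _

theorem integrable_mul_mergelyanKernel (hψ : Continuous ψ) (hψc : HasCompactSupport ψ) (z : ℂ) :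
    Integrable fun ζ => ψ ζ * mergelyanKernel (S ζ).1 (S ζ).2 ζ z := by
  simp only [mul_mergelyanKernel_eq_sum]
  exact integrable_finsetSum _ fun s _ => (integrable_indicator_mul_slitKernel S hψ hψc s z).add
    (integrable_indicator_mul_sub_mul_slitKernel_sq S hψ hψc s z)

theorem slitCauchy_eq_sum (hψ : Continuous ψ) (hψc : HasCompactSupport ψ) (z : ℂ) :
    slitCauchy S ψ z = (2 * π : ℂ)⁻¹ * ∑ s ∈ S.range,
      ((∫ ζ, (S ⁻¹' {s}).indicator ψ ζ) * slitKernel s.1 s.2 z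
        + (∫ ζ, (S ⁻¹' {s}).indicator (fun ζ => ψ ζ * (ζ - s.1)) ζ)
          * slitKernel s.1 s.2 z ^ 2) := by
  have hint := fun s => integrable_indicator_mul_slitKernel S hψ hψc s z
  have hint' := fun s => integrable_indicator_mul_sub_mul_slitKernel_sq S hψ hψc s z
  simp only [slitCauchy, mul_mergelyanKernel_eq_sum]
  rw [integral_finsetSum _ fun s _ => (hint s).fun_add (hint' s)]
  congr 1
  refine Finset.sum_congr rfl fun s _ => ?_
  rw [integral_add (hint s) (hint' s), integral_mul_const, integral_mul_const]

theorem polyApprox_slitCauchy (hψ : Continuous ψ) (hψc : HasCompactSupport ψ) (hK : IsCompact K)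
    (hstar : StarConvex ℝ 0 K) (hslit : ∀ ζ, ∀ z ∈ K, (z - (S ζ).1) / (S ζ).2 ∉ unitSlit) :
    PolyApprox K (slitCauchy S ψ) := by
  refine PolyApprox.of_differentiableOn_of_starConvex hK
    (U := ⋂ s ∈ S.range, (fun z => (z - s.1) / s.2) ⁻¹' unitSlitᶜ) ?_ ?_ hstar ?_
  · exact isOpen_biInter_finset fun s _ => isClosed_unitSlit.isOpen_compl.preimage (by fun_prop)
  · intro z hz
    refine mem_iInter₂.2 fun s hs => ?_
    obtain ⟨ζ, rfl⟩ := SimpleFunc.mem_range.1 hs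
    exact hslit ζ z hz
  · rw [funext (slitCauchy_eq_sum S hψ hψc)]
    intro z hz
    refine DifferentiableAt.differentiableWithinAt ?_
    refine (differentiableAt_const _).mul (DifferentiableAt.fun_sum fun s hs => ?_)
    have := differentiableAt_slitKernel (mem_iInter₂.1 hz s hs)
    fun_prop

end

theorem norm_mul_mergelyanKernel_sub_le {m d z ζ a : ℂ} {δ B : ℝ} (hδ : 0 < δ) (hd : ‖d‖ = δ)
    (hz : (z - m) / d ∉ unitSlit) (hne : z ≠ ζ) (ha : ‖a‖ ≤ B)
    (hζ : a ≠ 0 → ‖ζ - m‖ ≤ 5 * δ) :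
    ‖a * mergelyanKernel m d ζ z - a * (1 / (z - ζ))‖
      ≤ B * 30000 * kernelMajorant δ ‖z - ζ‖ := by
  have hmaj := kernelMajorant_nonneg δ (norm_nonneg (z - ζ))
  have hB : 0 ≤ B := (norm_nonneg _).trans ha
  rw [← mul_sub, norm_mul, mul_assoc]
  subst hd
  by_cases ha0 : a = 0
  · rw [ha0, norm_zero, zero_mul]
    positivity
  · exact mul_le_mul ha (norm_mergelyanKernel_sub_le (norm_pos_iff.1 hδ) hz (hζ ha0) hne)
      (norm_nonneg _) hB

theorem norm_slitCauchy_dbar_sub_le {Φ : ℂ → ℂ} {δ B : ℝ} (hδ : 0 < δ) (hΦ : ContDiff ℝ 1 Φ)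
    (hΦc : HasCompactSupport Φ) (hB : ∀ ζ, ‖dbar Φ ζ‖ ≤ B) (hS : ∀ ζ, ‖(S ζ).2‖ = δ)
    {z : ℂ} (hslit : ∀ ζ, (z - (S ζ).1) / (S ζ).2 ∉ unitSlit)
    (hnear : ∀ ζ, dbar Φ ζ ≠ 0 → ‖ζ - (S ζ).1‖ ≤ 5 * δ) :
    ‖slitCauchy S (dbar Φ) z - Φ z‖ ≤ 15000 * π * (B * δ) := by
  set D : ℂ → ℂ := fun ζ =>
    dbar Φ ζ * mergelyanKernel (S ζ).1 (S ζ).2 ζ z - dbar Φ ζ * (1 / (z - ζ))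
  have hDle : ∀ᵐ ζ, ‖D ζ‖ ≤ B * 30000 * kernelMajorant δ ‖z - ζ‖ := by
    filter_upwards [show ∀ᵐ ζ : ℂ, ζ ≠ z by simp [ae_iff]] with ζ hζ
    exact norm_mul_mergelyanKernel_sub_le hδ (hS ζ) (hslit ζ) hζ.symm (hB ζ) (hnear ζ)
  have hmaj : Integrable fun ζ : ℂ => B * 30000 * kernelMajorant δ ‖z - ζ‖ :=
    ((integrable_kernelMajorant hδ).comp_sub_left z).const_mul _
  have hsubst :=
    integrable_mul_mergelyanKernel S (continuous_dbar hΦ) (hasCompactSupport_dbar hΦc) z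
  have hcauchy : Integrable fun ζ => dbar Φ ζ * (1 / (z - ζ)) := by
    have hmeas : Measurable fun ζ : ℂ => dbar Φ ζ * (1 / (z - ζ)) :=
      (continuous_dbar hΦ).measurable.mul (by fun_prop)
    have hDint := hmaj.mono' (hsubst.aestronglyMeasurable.sub hmeas.aestronglyMeasurable) hDle
    exact (hsubst.sub hDint).congr (.of_forall fun ζ => sub_sub_cancel _ _)
  have hpi : (2 * π : ℂ) ≠ 0 := by exact_mod_cast two_pi_pos.ne'
  have herror : slitCauchy S (dbar Φ) z - Φ z = (2 * π : ℂ)⁻¹ * ∫ ζ, D ζ := by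
    rw [integral_sub hsubst hcauchy, integral_dbar_mul_cauchyKernel hΦ hΦc, slitCauchy, mul_sub,
      inv_mul_cancel_left₀ hpi]
  have hnorm : ‖(2 * π : ℂ)⁻¹‖ = (2 * π)⁻¹ := by
    rw [norm_inv, norm_mul, Complex.norm_ofNat, Complex.norm_real, Real.norm_of_nonneg pi_pos.le]
  have hint := norm_integral_le_of_norm_le hmaj hDle
  rw [integral_const_mul, integral_sub_left_eq_self (fun u : ℂ => kernelMajorant δ ‖u‖),
    integral_kernelMajorant hδ] at hint
  rw [herror, norm_mul, hnorm]
  calc _ ≤ (2 * π)⁻¹ * (B * 30000 * (π ^ 2 * δ)) := by gcongr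
    _ = 15000 * π * (B * δ) := by field_simp; ring

end SlitCauchy

theorem exists_notMem_dist_lt_of_mem_tsupport_dbar_mollify {K : Set ℂ} {f : ℂ → ℂ} {δ : ℝ}
    (hδ : 0 < δ) (hf : Continuous f) (hfd : DifferentiableOn ℂ f (interior K)) {ζ : ℂ}
    (hζ : ζ ∈ tsupport (dbar (mollify δ f))) : ∃ p ∈ Kᶜ, dist ζ p < 3 * δ := by
  obtain ⟨w, hw, hζw⟩ := mem_closure_iff.1 hζ δ hδ
  have hball : ¬ ball w (2 * δ) ⊆ K := fun h =>
    hw (dbar_mollify_eq_zero hδ hf (hfd.mono (interior_maximal h isOpen_ball)))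
  obtain ⟨p, hp, hpK⟩ := not_subset.1 hball
  exact ⟨p, hpK, by linarith [dist_triangle ζ w p, mem_ball'.1 hp]⟩

namespace PolyApprox

variable {K : Set ℂ} {F : ℂ → ℂ}

theorem of_continuousOn_of_starConvex_zero (hK : IsCompact K) (hstar : StarConvex ℝ 0 K)
    (hF : ContinuousOn F K) (hFd : DifferentiableOn ℂ F (interior K)) : PolyApprox K F := by
  obtain ⟨f, hf, hfc, hfF⟩ := exists_hasCompactSupport_eqOn hK hF
  have hfd : DifferentiableOn ℂ f (interior K) := hFd.congr fun z hz => hfF (interior_subset hz)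
  refine of_approx fun ε hε => ?_
  have hC := mollifierConst_nonneg
  set C : ℝ := 30000 * π * mollifierConst + 1 with hCdef
  have hC0 : 0 < C := by positivity
  set ε' : ℝ := ε / (2 * C) with hε'
  have hε'0 : 0 < ε' := by positivity
  obtain ⟨η, hη, hmod⟩ := uniformContinuous_iff.1 (hfc.uniformContinuous_of_continuous hf) ε' hε'0
  set δ : ℝ := η / 2
  have hδ : 0 < δ := by positivity
  have hclose : ∀ z, ∀ x ∈ ball z (2 * δ), dist (f x) (f z) ≤ ε' := fun z x hx =>
    (hmod ((mem_ball.1 hx).trans_eq (by ring))).le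
  set Φ := mollify δ f
  have hΦ : ContDiff ℝ 1 Φ := contDiff_mollify hδ hf
  have hΦc : HasCompactSupport Φ := hasCompactSupport_mollify hδ hfc
  obtain ⟨S, hS, hslit, hnear⟩ := exists_simpleFunc_slit hK.ne_univ
    (segmentAccessible_of_starConvex hstar hδ) (hasCompactSupport_dbar hΦc).isCompact
    fun ζ => exists_notMem_dist_lt_of_mem_tsupport_dbar_mollify hδ hf hfd
  refine ⟨slitCauchy S (dbar Φ), polyApprox_slitCauchy S (continuous_dbar hΦ)
    (hasCompactSupport_dbar hΦc) hK hstar hslit, fun z hz => ?_⟩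
  have hsmooth : ‖Φ z - F z‖ ≤ ε' := hfF hz ▸ norm_mollify_sub_le hδ hf hε'0.le
    fun x hx => hclose z x (ball_subset_ball (by linarith) hx)
  have hkernel := norm_slitCauchy_dbar_sub_le hδ hΦ hΦc
    (fun ζ => norm_dbar_mollify_le hδ hf hε'0.le (hclose ζ)) hS (fun ζ => hslit ζ z hz)
    fun ζ hζ => (hnear ζ (subset_tsupport _ hζ)).trans (by linarith)
  calc ‖F z - slitCauchy S (dbar Φ) z‖
      ≤ ‖slitCauchy S (dbar Φ) z - Φ z‖ + ‖Φ z - F z‖ := by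
        rw [norm_sub_rev]
        exact norm_sub_le_norm_sub_add_norm_sub _ _ _
    _ ≤ 15000 * π * (2 * (mollifierConst / δ * ε') * δ) + ε' := add_le_add hkernel hsmooth
    _ = C * ε' := by rw [hCdef]; field_simp; ring
    _ = ε / 2 := by rw [hε']; field_simp
    _ < ε := half_lt_self hε

theorem of_continuousOn_of_starConvex (hK : IsCompact K) {c : ℂ} (hstar : StarConvex ℝ c K)
    (hF : ContinuousOn F K) (hFd : DifferentiableOn ℂ F (interior K)) : PolyApprox K F := by
  set L : Set ℂ := Homeomorph.addRight c ⁻¹' K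
  have hL : PolyApprox L fun z => F (z + c) := by
    refine of_continuousOn_of_starConvex_zero ((Homeomorph.isCompact_preimage _).2 hK) ?_
      (hF.comp (by fun_prop) fun z hz => hz) ?_
    · exact StarConvex.preimage_add_left (by rwa [zero_add])
    · rw [← Homeomorph.preimage_interior]
      exact hFd.comp (by fun_prop) fun z hz => hz
  refine (hL.comp_polynomial (L := K) (Polynomial.X - Polynomial.C c) ?_).congr ?_ <;> simp [L]

end PolyApprox

end Mergelyan

section StarShapedJordanRegion

open Set Metric Topology Filter

theorem isPreconnected_compl_singleton_circle (x : Circle) :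
    IsPreconnected ({x}ᶜ : Set Circle) := by
  have : Fact (Module.finrank ℝ ℂ = 1 + 1) := ⟨Complex.finrank_real_complex⟩
  let e := stereographic' 1 (show sphere (0 : ℂ) 1 from x)
  have htarget : e.target = univ := stereographic'_target _
  have hsource : e.source = {x}ᶜ := stereographic'_source _
  have himage : e.symm '' univ = {x}ᶜ := by
    rw [← htarget, e.symm_image_target_eq_source, hsource]
  exact himage ▸ isPreconnected_univ.image _ (htarget ▸ e.continuousOn_symm)

theorem exists_isPreconnected_mem_nhdsWithin_range {X Y : Type*} [TopologicalSpace X]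
    [LocallyConnectedSpace X] [TopologicalSpace Y] {γ : X → Y} (hγ : IsEmbedding γ) (x : X)
    {W : Set Y} (hW : W ∈ 𝓝 (γ x)) :
    ∃ N ⊆ W, IsPreconnected N ∧ N ⊆ range γ ∧ N ∈ 𝓝[range γ] γ x := by
  obtain ⟨V, hVW, hVo, hxV, hV⟩ := locallyConnectedSpace_iff_subsets_isOpen_isConnected.1 ‹_› x
    (γ ⁻¹' W) (hγ.continuous.continuousAt hW)
  refine ⟨γ '' V, image_subset_iff.2 hVW, hV.isPreconnected.image _ hγ.continuous.continuousOn,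
    image_subset_range _ _, ?_⟩
  rw [← hγ.isInducing.map_nhds_eq]
  exact image_mem_map (hVo.mem_nhds hxV)

theorem continuousOn_im_div_re : ContinuousOn (fun z : ℂ => z.im / z.re) {z | 0 < z.re} :=
  Complex.continuous_im.continuousOn.div Complex.continuous_re.continuousOn fun _ hz => ne_of_gt hz

variable {D : Set ℂ}

theorem mem_of_im_div_re_eq (hstar : StarConvex ℝ 0 D) {y z : ℂ} (hy : y ∈ D) (hz : 0 < z.re)
    (hzy : z.re ≤ y.re) (h : z.im / z.re = y.im / y.re) : z ∈ D := by
  have hy0 : 0 < y.re := hz.trans_le hzy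
  have hscale : z = (z.re / y.re) • y := by
    apply Complex.ext
    · rw [Complex.smul_re, smul_eq_mul, div_mul_cancel₀ _ hy0.ne']
    · rw [Complex.smul_im, smul_eq_mul, div_mul_eq_mul_div, mul_div_assoc, ← h,
        mul_div_cancel₀ _ hz.ne']
  rw [hscale]
  exact hstar.smul_mem hy (by positivity) ((div_le_one hy0).2 hzy)

theorem exists_mem_lt_re_of_mem_interior_closure {R s : ℝ} (hR : (R : ℂ) ∈ interior (closure D))
    (hR0 : 0 < R) (hs : s ≠ 0) : ∃ y ∈ D, R < y.re ∧ y.im / y.re / s ∈ Ioo 0 1 := by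
  set p : ℝ → ℂ := fun t => ⟨R + t, (R + t) * (s * t)⟩ with hp
  have hpcont : Continuous p := Complex.equivRealProdCLM.symm.continuous.comp
    (by fun_prop : Continuous fun t : ℝ => (R + t, (R + t) * (s * t)))
  have hnear : ∀ᶠ t in 𝓝[>] (0 : ℝ), p t ∈ interior (closure D) := by
    refine nhdsWithin_le_nhds (hpcont.continuousAt (isOpen_interior.mem_nhds ?_))
    convert hR using 1
    simp [hp, Complex.ext_iff]
  obtain ⟨t, htD, ht0, ht1⟩ := (hnear.and (Ioo_mem_nhdsGT one_pos)).exists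
  have hopen : IsOpen ({z : ℂ | R < z.re} ∩ (fun z : ℂ => z.im / z.re / s) ⁻¹' Ioo 0 1) :=
    ((continuousOn_im_div_re.div_const s).mono fun z hz => hR0.trans hz).isOpen_inter_preimage
      (isOpen_lt continuous_const Complex.continuous_re) isOpen_Ioo
  have hslope : (p t).im / (p t).re / s = t := by
    have : R + t ≠ 0 := by positivity
    simp only [hp]
    field_simp
  obtain ⟨y, hy, hyD⟩ := mem_closure_iff.1 (interior_subset htD) _ hopen
    ⟨by simpa [hp] using ht0, by rw [mem_preimage, hslope]; exact ⟨ht0, ht1⟩⟩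
  exact ⟨y, hyD, hy⟩

-- A point of `N` off the real axis forces `N` to meet all smaller slopes, while some of these
-- slopes belong to points of `D` to the right of `N`, whose segments to `0` would then cross `N`.
theorem im_eq_zero_of_isPreconnected (hstar : StarConvex ℝ 0 D) {N : Set ℂ}
    (hN : IsPreconnected N) (hND : Disjoint N D) (h1 : (1 : ℂ) ∈ N) {R : ℝ}
    (hR : (R : ℂ) ∈ interior (closure D)) (hNR : ∀ z ∈ N, z.re ∈ Ioo 0 R) {z : ℂ} (hz : z ∈ N) :
    z.im = 0 := by
  by_contra him
  set s : ℝ := z.im / z.re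
  have hs : s ≠ 0 := div_ne_zero him (hNR z hz).1.ne'
  have hcover : Icc 0 1 ⊆ (fun w : ℂ => w.im / w.re / s) '' N := by
    have := hN.intermediate_value h1 hz
      ((continuousOn_im_div_re.div_const s).mono fun w hw => (hNR w hw).1)
    simpa [s, div_self hs] using this
  obtain ⟨y, hyD, hyR, hys⟩ := exists_mem_lt_re_of_mem_interior_closure hR
    ((hNR z hz).1.trans (hNR z hz).2) hs
  obtain ⟨w, hwN, hw⟩ := hcover (Ioo_subset_Icc_self hys)
  exact disjoint_left.1 hND hwN (mem_of_im_div_re_eq hstar hyD (hNR w hwN).1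
    ((hNR w hwN).2.trans hyR).le ((div_left_inj' hs).1 hw))

variable {γ : Circle → ℂ}

theorem exists_one_lt_mem_interior {S : Set ℂ} (h1 : (1 : ℂ) ∈ interior S) :
    ∃ R : ℝ, 1 < R ∧ (R : ℂ) ∈ interior S :=
  have h : ∀ᶠ t : ℝ in 𝓝[>] 1, (t : ℂ) ∈ interior S := nhdsWithin_le_nhds
    (Complex.continuous_ofReal.continuousAt (isOpen_interior.mem_nhds (by simpa using h1)))
  (eventually_mem_nhdsWithin.and h).exists

theorem eventually_im_eq_zero (hD : IsOpen D) (hstar : StarConvex ℝ 0 D) (hγ : Continuous γ)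
    (hinj : Function.Injective γ) (hrange : range γ = frontier D)
    (h1 : (1 : ℂ) ∈ interior (closure D)) (h1D : (1 : ℂ) ∉ D) :
    ∀ᶠ z in 𝓝 (1 : ℂ), z ∉ D → z.im = 0 := by
  have : LocallyConnectedSpace Circle :=
    ChartedSpace.locallyConnectedSpace (EuclideanSpace ℝ (Fin 1)) Circle
  obtain ⟨x, hx⟩ : (1 : ℂ) ∈ range γ := by
    rw [hrange, hD.frontier_eq]
    exact ⟨interior_subset h1, h1D⟩
  obtain ⟨R, h1R, hR⟩ := exists_one_lt_mem_interior h1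
  have hstrip : Complex.re ⁻¹' Ioo 0 R ∈ 𝓝 (γ x) :=
    (isOpen_Ioo.preimage Complex.continuous_re).mem_nhds (by simpa [hx] using h1R)
  obtain ⟨N, hNR, hN, hNγ, hNx⟩ := exists_isPreconnected_mem_nhdsWithin_range
    (hγ.isClosedEmbedding hinj).isEmbedding x hstrip
  rw [hrange, hD.frontier_eq] at hNγ
  rw [hx, hrange] at hNx
  have h1N : (1 : ℂ) ∈ N := mem_of_mem_nhdsWithin
    (by rw [hD.frontier_eq]; exact ⟨interior_subset h1, h1D⟩) hNx
  filter_upwards [mem_nhdsWithin_iff_eventually.1 hNx, isOpen_interior.mem_nhds h1]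
    with z hzN hz hzD
  refine im_eq_zero_of_isPreconnected hstar hN (disjoint_left.2 fun w hw => (hNγ hw).2) h1N hR hNR
    (hzN ?_)
  rw [hD.frontier_eq]
  exact ⟨interior_subset hz, hzD⟩

theorem isOpen_re_lt_one_inter_sector (ρ : ℝ) :
    IsOpen {z : ℂ | 0 < z.re ∧ z.re < 1 ∧ |z.im / z.re| < ρ} := by
  have h := (continuousOn_im_div_re.isOpen_inter_preimage
    (isOpen_lt continuous_const Complex.continuous_re)
    (isOpen_lt continuous_abs (continuous_const (y := ρ)))).inter
    (isOpen_lt Complex.continuous_re (continuous_const (y := (1 : ℝ))))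
  convert h using 1
  ext z
  simp only [mem_inter_iff, mem_preimage, mem_ofPred_eq]
  tauto

theorem exists_im_eq_zero_of_notMem_of_sector (hstar : StarConvex ℝ 0 D)
    (h : ∀ᶠ z in 𝓝 (1 : ℂ), z ∉ D → z.im = 0) :
    ∃ ρ > 0, ∀ z : ℂ, 0 < z.re → z.re < 1 → |z.im / z.re| < ρ → z ∉ D → z.im = 0 := by
  obtain ⟨ρ, hρ, hball⟩ := Metric.eventually_nhds_iff.1 h
  refine ⟨ρ, hρ, fun z hz0 hz1 hzρ hzD => ?_⟩
  have hy : dist (⟨1, z.im / z.re⟩ : ℂ) 1 < ρ := by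
    rw [dist_eq_norm]
    refine (Complex.norm_le_abs_re_add_abs_im _).trans_lt ?_
    simpa only [Complex.sub_re, Complex.one_re, sub_self, abs_zero, zero_add, Complex.sub_im,
      Complex.one_im, sub_zero]
  exact (div_eq_zero_iff.1 (hball hy fun hyD =>
    hzD (mem_of_im_div_re_eq hstar hyD hz0 hz1.le (by simp)))).resolve_right hz0.ne'

-- Near the segment `[0, 1]` the curve lies in the real axis, so removing the point `1` separates
-- the points `a < 1` and `R > 1` of the curve from each other.
theorem ofReal_mem_of_one_mem_interior_closure (hD : IsOpen D) (h0 : (0 : ℂ) ∈ D)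
    (hstar : StarConvex ℝ 0 D) (hγ : Continuous γ) (hinj : Function.Injective γ)
    (hrange : range γ = frontier D) {a : ℝ} (ha0 : 0 < a) (ha1 : a < 1)
    (h1 : (1 : ℂ) ∈ interior (closure D)) (ha : (a : ℂ) ∈ closure D) : (a : ℂ) ∈ D := by
  by_contra haD
  have hray : ∀ t : ℝ, a ≤ t → (t : ℂ) ∉ D := fun t hat htD =>
    haD (mem_of_im_div_re_eq hstar htD (by simpa) (by simpa) (by simp))
  obtain ⟨R, h1R, hR⟩ := exists_one_lt_mem_interior h1
  obtain ⟨ρ, hρ, hsector⟩ := exists_im_eq_zero_of_notMem_of_sector hstar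
    (eventually_im_eq_zero hD hstar hγ hinj hrange h1 (by simpa using hray 1 ha1.le))
  have hfrontier : ∀ z, z ∈ frontier D ↔ z ∈ closure D ∧ z ∉ D := fun z => by
    rw [hD.frontier_eq, Set.mem_sdiff]
  obtain ⟨x, hx⟩ : (1 : ℂ) ∈ range γ := by
    rw [hrange, hfrontier]
    exact ⟨interior_subset h1, by simpa using hray 1 ha1.le⟩
  have himage : γ '' {x}ᶜ = frontier D \ {1} := by
    rw [image_compl_eq_range_sdiff_image hinj, hrange, image_singleton, hx]
  have hconn : IsPreconnected (frontier D \ {1}) :=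
    himage ▸ (isPreconnected_compl_singleton_circle x).image _ hγ.continuousOn
  set B : Set ℂ := ((fun t : ℝ => (t : ℂ)) '' Icc 0 1)ᶜ with hB
  have hBopen : IsOpen B := (isCompact_Icc.image Complex.continuous_ofReal).isClosed.isOpen_compl
  have hcover : frontier D \ {1} ⊆ {z : ℂ | 0 < z.re ∧ z.re < 1 ∧ |z.im / z.re| < ρ} ∪ B := by
    rintro z ⟨hz, hz1⟩
    refine or_iff_not_imp_right.2 fun hzB => ?_
    obtain ⟨t, ⟨ht0, ht1⟩, rfl⟩ := not_not.1 hzB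
    have ht0' : t ≠ 0 := by rintro rfl; exact ((hfrontier _).1 hz).2 (by simpa using h0)
    have ht1' : t ≠ 1 := by rintro rfl; exact hz1 (by simp)
    simpa using ⟨lt_of_le_of_ne ht0 ht0'.symm, lt_of_le_of_ne ht1 ht1', hρ⟩
  obtain ⟨z, ⟨hz, -⟩, ⟨hz0, hz1, hzρ⟩, hzB⟩ := hconn _ B (isOpen_re_lt_one_inter_sector ρ) hBopen
    hcover
    ⟨a, ⟨(hfrontier _).2 ⟨ha, haD⟩, by simpa using ha1.ne⟩, by simpa using ⟨ha0, ha1, hρ⟩⟩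
    ⟨R, ⟨(hfrontier _).2 ⟨interior_subset hR, hray R (ha1.trans h1R).le⟩, by simpa using h1R.ne'⟩,
      by simpa [hB] using fun _ => h1R⟩
  have him := hsector z hz0 hz1 hzρ ((hfrontier z).1 hz).2
  exact hzB ⟨z.re, ⟨hz0.le, hz1.le⟩, Complex.ext rfl him.symm⟩

theorem interior_closure_subset_of_starConvex_of_range_eq_frontier (hD : IsOpen D) {c : ℂ}
    (hc : c ∈ D) (hstar : StarConvex ℝ c D) (hγ : Continuous γ) (hinj : Function.Injective γ)
    (hrange : range γ = frontier D) : interior (closure D) ⊆ D := by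
  intro w hw
  by_cases hwc : w = c
  · rwa [hwc]
  obtain ⟨R, h1R, hR⟩ : ∃ R : ℝ, 1 < R ∧ c + R • (w - c) ∈ interior (closure D) := by
    have h : ∀ᶠ t : ℝ in 𝓝[>] 1, c + t • (w - c) ∈ interior (closure D) := nhdsWithin_le_nhds
      ((by fun_prop : Continuous fun t : ℝ => c + t • (w - c)).continuousAt
        (isOpen_interior.mem_nhds (by simpa using hw)))
    exact (eventually_mem_nhdsWithin.and h).exists
  have hR0 : 0 < R := one_pos.trans h1R
  have hb : R • (w - c) ≠ 0 := smul_ne_zero hR0.ne' (sub_ne_zero.2 hwc)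
  let h : ℂ ≃ₜ ℂ := (Homeomorph.mulRight₀ _ hb).trans (Homeomorph.addLeft c)
  have hh : ∀ z, h z = c + z * R • (w - c) := fun z => rfl
  have hw' : h (R⁻¹ : ℝ) = w := by
    rw [hh, ← Complex.real_smul, inv_smul_smul₀ hR0.ne', add_sub_cancel]
  suffices ((R⁻¹ : ℝ) : ℂ) ∈ h ⁻¹' D by rwa [mem_preimage, hw'] at this
  refine ofReal_mem_of_one_mem_interior_closure (γ := h.symm ∘ γ) (hD.preimage h.continuous) ?_ ?_
    (h.symm.continuous.comp hγ) (h.symm.injective.comp hinj) ?_ (inv_pos.2 hR0)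
    (inv_lt_one_of_one_lt₀ h1R) ?_ ?_
  · simpa [hh] using hc
  · refine starConvex_zero_iff.2 fun z hz t ht0 ht1 => ?_
    rw [mem_preimage, hh] at hz ⊢
    simpa only [Complex.real_smul, mul_assoc] using hstar.add_smul_mem hz ht0 ht1
  · rw [← h.preimage_frontier, ← hrange, range_comp, h.image_symm]
  · rw [← h.preimage_closure, ← h.preimage_interior, mem_preimage, hh, one_mul]
    exact hR
  · rw [← h.preimage_closure, mem_preimage, hw']
    exact interior_subset hw

theorem IsBoundedJordanRegion.interior_closure_subset {D : Set ℂ} (hD : IsBoundedJordanRegion D)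
    {c : ℂ} (hc : c ∈ D) (hstar : StarConvex ℝ c D) : interior (closure D) ⊆ D := by
  obtain ⟨hopen, -, -, γ, hγ, hinj, hrange⟩ := hD
  exact interior_closure_subset_of_starConvex_of_range_eq_frontier hopen hc hstar hγ hinj hrange

end StarShapedJordanRegion

section SlicePlanes

open Set Filter Topology

/-- The embedding `x + i y ↦ x + I y` of the complex plane onto `ℂ_I`, as a real linear map. -/
noncomputable def sliceEmb (I : ℍ[ℝ]) : ℂ →L[ℝ] ℍ[ℝ] :=
  Complex.reCLM.smulRight 1 + Complex.imCLM.smulRight I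

variable {I J : ℍ[ℝ]} {U : Set ℍ[ℝ]}

theorem sliceEmb_apply (I : ℍ[ℝ]) (z : ℂ) : sliceEmb I z = (z.re : ℍ[ℝ]) + z.im • I := by
  rw [← mul_one (z.re : ℍ[ℝ]), Quaternion.coe_mul_eq_smul]
  rfl

theorem slicePoint_eq_sliceEmb (I : ℍ[ℝ]) (x y : ℝ) : slicePoint I x y = sliceEmb I ⟨x, y⟩ := by
  rw [sliceEmb_apply, slicePoint, Quaternion.mul_coe_eq_smul]

theorem mem_sliceSet {z : ℂ} : z ∈ sliceSet U I ↔ sliceEmb I z ∈ U := by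
  rw [sliceSet, mem_ofPred_eq, slicePoint_eq_sliceEmb]

theorem sliceEmb_ofReal (I : ℍ[ℝ]) (x : ℝ) : sliceEmb I x = (x : ℍ[ℝ]) := by
  simp [sliceEmb_apply]

theorem sliceEmb_neg (I : ℍ[ℝ]) (z : ℂ) : sliceEmb (-I) z = sliceEmb I (star z) := by
  simp [sliceEmb_apply]

theorem continuous_sliceEmb : Continuous fun p : ℍ[ℝ] × ℂ => sliceEmb p.1 p.2 := by
  simp only [sliceEmb_apply]
  exact (Quaternion.continuous_coe.comp (by fun_prop)).add (by fun_prop)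

theorem neg_mem_imagUnitSphere (hI : I ∈ imagUnitSphere) : -I ∈ imagUnitSphere :=
  ⟨by rw [Quaternion.re_neg, hI.1, neg_zero], by rw [norm_neg, hI.2]⟩

theorem im_of_mem_imagUnitSphere (hI : I ∈ imagUnitSphere) : I.im = I := by
  simpa [hI.1] using Quaternion.re_add_im I

theorem mul_self_of_mem_imagUnitSphere (hI : I ∈ imagUnitSphere) : I * I = -1 := by
  have hstar : star I = -I := Quaternion.star_eq_neg.2 hI.1
  rw [← neg_inj, neg_neg, ← mul_neg, ← hstar, Quaternion.self_mul_star,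
    Quaternion.normSq_eq_norm_mul_self, hI.2, mul_one, Quaternion.coe_one]

theorem sliceEmb_eq_liftAux (hI : I ∈ imagUnitSphere) (z : ℂ) :
    sliceEmb I z = Complex.liftAux I (mul_self_of_mem_imagUnitSphere hI) z := by
  rw [sliceEmb_apply, Complex.liftAux_apply]
  rfl

theorem sliceEmb_mul (hI : I ∈ imagUnitSphere) (z w : ℂ) :
    sliceEmb I (z * w) = sliceEmb I z * sliceEmb I w := by
  simp only [sliceEmb_eq_liftAux hI, map_mul]

theorem sliceEmb_pow (hI : I ∈ imagUnitSphere) (z : ℂ) (k : ℕ) :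
    sliceEmb I (z ^ k) = sliceEmb I z ^ k := by
  simp only [sliceEmb_eq_liftAux hI, map_pow]

theorem re_sliceEmb (hI : I ∈ imagUnitSphere) (z : ℂ) : (sliceEmb I z).re = z.re := by
  simp [sliceEmb_apply, hI.1]

theorem im_sliceEmb (hI : I ∈ imagUnitSphere) (z : ℂ) : (sliceEmb I z).im = z.im • I := by
  simp [sliceEmb_apply, im_of_mem_imagUnitSphere hI]

theorem norm_im_sliceEmb (hI : I ∈ imagUnitSphere) (z : ℂ) : ‖(sliceEmb I z).im‖ = |z.im| := by
  rw [im_sliceEmb hI, norm_smul, hI.2, mul_one, Real.norm_eq_abs]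

theorem norm_sliceEmb (hI : I ∈ imagUnitSphere) (z : ℂ) : ‖sliceEmb I z‖ = ‖z‖ := by
  have hstar : star (sliceEmb I z) = sliceEmb I (star z) := by
    simp [sliceEmb_apply, Quaternion.star_eq_neg.2 hI.1]
  have hsq : ((‖sliceEmb I z‖ * ‖sliceEmb I z‖ : ℝ) : ℍ[ℝ]) = (‖z‖ * ‖z‖ : ℝ) := by
    rw [← Quaternion.normSq_eq_norm_mul_self, ← Quaternion.self_mul_star, hstar,
      ← sliceEmb_mul hI, ← sliceEmb_ofReal I, Complex.star_def, Complex.mul_conj,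
      Complex.normSq_eq_norm_sq, pow_two]
  exact (mul_self_inj (norm_nonneg _) (norm_nonneg _)).1 (Quaternion.coe_injective hsq)

theorem isClosedEmbedding_sliceEmb (hI : I ∈ imagUnitSphere) : IsClosedEmbedding (sliceEmb I) :=
  (AddMonoidHomClass.isometry_of_norm (sliceEmb I) (norm_sliceEmb hI)).isClosedEmbedding

theorem inv_smul_im_mem_imagUnitSphere {q : ℍ[ℝ]} {y : ℝ} (hy : |y| = ‖q.im‖) (hq : q.im ≠ 0) :
    y⁻¹ • q.im ∈ imagUnitSphere :=
  ⟨by simp, by rw [norm_smul, norm_inv, Real.norm_eq_abs, hy,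
    inv_mul_cancel₀ (norm_ne_zero_iff.2 hq)]⟩

theorem sliceEmb_inv_smul_im (q : ℍ[ℝ]) {y : ℝ} (hy : y ≠ 0) :
    sliceEmb (y⁻¹ • q.im) ⟨q.re, y⟩ = q := by
  rw [sliceEmb_apply, smul_inv_smul₀ hy, Quaternion.re_add_im]

theorem imagUnitSphere_nonempty : imagUnitSphere.Nonempty :=
  ⟨_, inv_smul_im_mem_imagUnitSphere (q := ⟨0, 1, 0, 0⟩) (abs_norm _)
    fun h => one_ne_zero (congrArg QuaternionAlgebra.imI h)⟩

theorem exists_sliceEmb_eq (q : ℍ[ℝ]) : ∃ J ∈ imagUnitSphere, ∃ z, sliceEmb J z = q := by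
  by_cases hq : q.im = 0
  · obtain ⟨J, hJ⟩ := imagUnitSphere_nonempty
    refine ⟨J, hJ, q.re, ?_⟩
    rw [sliceEmb_ofReal, ← add_zero (q.re : ℍ[ℝ]), ← hq, Quaternion.re_add_im]
  · exact ⟨_, inv_smul_im_mem_imagUnitSphere (abs_norm _) hq, _,
      sliceEmb_inv_smul_im q (norm_ne_zero_iff.2 hq)⟩

theorem isCompact_imagUnitSphere : IsCompact imagUnitSphere := by
  refine (isCompact_sphere (0 : ℍ[ℝ]) 1).of_isClosed_subset ?_ fun I hI => by simpa using hI.2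
  exact (isClosed_eq Quaternion.continuous_re continuous_const).inter
    (isClosed_eq continuous_norm continuous_const)

theorem isOpen_sliceSet (hU : IsOpen U) (I : ℍ[ℝ]) : IsOpen (sliceSet U I) := by
  convert hU.preimage (sliceEmb I).continuous using 1
  exact ext fun _ => mem_sliceSet

theorem isCompact_sliceSet (hU : IsCompact U) (hI : I ∈ imagUnitSphere) :
    IsCompact (sliceSet U I) := by
  convert (isClosedEmbedding_sliceEmb hI).isCompact_preimage hU using 1
  exact ext fun _ => mem_sliceSet

theorem sliceSet_eq_of_isAxiallySymmetric (hU : IsAxiallySymmetric U) (hI : I ∈ imagUnitSphere)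
    (hJ : J ∈ imagUnitSphere) : sliceSet U I = sliceSet U J :=
  Subset.antisymm (fun z hz => hU z.re z.im I hI hz J hJ) fun z hz => hU z.re z.im J hJ hz I hI

theorem sliceSet_neg (U : Set ℍ[ℝ]) (I : ℍ[ℝ]) : sliceSet U (-I) = star ⁻¹' sliceSet U I := by
  ext z
  rw [mem_sliceSet, sliceEmb_neg, mem_preimage, mem_sliceSet]

theorem sliceSet_subset_sliceSet_closure (U : Set ℍ[ℝ]) (I : ℍ[ℝ]) :
    sliceSet U I ⊆ sliceSet (closure U) I :=
  fun _ hz => subset_closure hz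

theorem starConvex_sliceSet {x : ℝ} (hU : StarConvex ℝ (x : ℍ[ℝ]) U) (I : ℍ[ℝ]) :
    StarConvex ℝ (x : ℂ) (sliceSet U I) := by
  intro z hz a b ha hb hab
  have := hU (mem_sliceSet.1 hz) ha hb hab
  rwa [← sliceEmb_ofReal I, ← map_smul, ← map_smul, ← map_add, ← mem_sliceSet] at this

end SlicePlanes

section DenseSlices

open Set Filter Topology

-- The sets `{x | V meets the slice of U over x}`, for `V` in a countable basis, are open and dense,
-- so Baire's theorem applies to them.
theorem dense_setOf_subset_closure_preimage_mk {X Y : Type*} [TopologicalSpace X] [BaireSpace X]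
    [TopologicalSpace Y] [SecondCountableTopology Y] {U : Set (X × Y)} (hU : IsOpen U) {F : Set Y}
    (hF : univ ×ˢ F ⊆ closure U) : Dense {x | F ⊆ closure (Prod.mk x ⁻¹' U)} := by
  set 𝓑 : Set (Set Y) := {V | V ∈ TopologicalSpace.countableBasis Y ∧ (V ∩ F).Nonempty}
  have hopen : ∀ V ∈ 𝓑, IsOpen V := fun V hV => TopologicalSpace.isOpen_of_mem_countableBasis hV.1
  have hdense : Dense (⋂ V ∈ 𝓑, Prod.fst '' (U ∩ univ ×ˢ V)) := by
    refine dense_biInter_of_isOpen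
      (fun V hV => isOpenMap_fst _ (hU.inter (isOpen_univ.prod (hopen V hV))))
      ((TopologicalSpace.countable_countableBasis Y).mono fun V hV => hV.1)
      fun V hV => dense_iff_inter_open.2 ?_
    rintro W hW ⟨x, hx⟩
    obtain ⟨y, hyV, hyF⟩ := hV.2
    obtain ⟨p, ⟨hpW, hpV⟩, hpU⟩ := mem_closure_iff.1 (hF (mk_mem_prod (mem_univ x) hyF))
      _ (hW.prod (hopen V hV)) ⟨hx, hyV⟩
    exact ⟨p.1, hpW, p, ⟨hpU, mem_univ _, hpV⟩, rfl⟩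
  refine hdense.mono fun x hx y hy => ?_
  rw [(TopologicalSpace.isBasis_countableBasis Y).mem_closure_iff]
  intro V hV hyV
  obtain ⟨p, ⟨hpU, -, hpV⟩, rfl⟩ := mem_iInter₂.1 hx V ⟨hV, y, hyV, hy⟩
  exact ⟨p.2, hpV, hpU⟩

variable {I : ℍ[ℝ]} {U : Set ℍ[ℝ]}

theorem dense_im_ne_zero : Dense {q : ℍ[ℝ] | q.im ≠ 0} := by
  obtain ⟨I, hI⟩ := imagUnitSphere_nonempty
  have hI0 : I ≠ 0 := norm_ne_zero_iff.1 (by rw [hI.2]; exact one_ne_zero)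
  intro q
  by_cases hq : q.im = 0
  · have hlim : Tendsto (fun t : ℝ => q + t • I) (𝓝[≠] 0) (𝓝 q) := by
      have h : Continuous fun t : ℝ => q + t • I := by fun_prop
      simpa using (h.tendsto 0).mono_left nhdsWithin_le_nhds
    refine mem_closure_of_tendsto hlim (eventually_mem_nhdsWithin.mono fun t ht => ?_)
    rw [mem_ofPred_eq, Quaternion.im_add, hq, zero_add, Quaternion.im_smul,
      im_of_mem_imagUnitSphere hI]
    exact smul_ne_zero ht hI0
  · exact subset_closure hq

theorem continuous_mk_re_mul_norm_im (σ : ℝ) :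
    Continuous fun q : ℍ[ℝ] => (⟨q.re, σ * ‖q.im‖⟩ : ℂ) :=
  Complex.equivRealProdCLM.symm.continuous.comp
    (Quaternion.continuous_re.prodMk (Quaternion.continuous_im.norm.const_mul σ))

-- Away from the real axis `q = x + J y ↦ (J, x + i y)` is continuous once the sign `σ` of `y`
-- is fixed.
theorem mem_closure_setOf_sliceEmb_mem {J : imagUnitSphere} {z : ℂ} (hz : z.im ≠ 0)
    (hJz : sliceEmb J z ∈ closure U) :
    (J, z) ∈ closure {p : imagUnitSphere × ℂ | sliceEmb p.1 p.2 ∈ U} := by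
  have hnorm : ‖(sliceEmb J z).im‖ = |z.im| := norm_im_sliceEmb J.2 z
  set σ : ℝ := z.im / |z.im|
  have hσ : |σ| = 1 := by rw [abs_div, abs_abs, div_self (abs_ne_zero.2 hz)]
  have hσz : σ * |z.im| = z.im := div_mul_cancel₀ _ (abs_ne_zero.2 hz)
  let s : ℍ[ℝ] → ℍ[ℝ] × ℂ := fun q => ((σ * ‖q.im‖)⁻¹ • q.im, ⟨q.re, σ * ‖q.im‖⟩)
  have hs : s (sliceEmb J z) = (↑J, z) := by
    simp only [s]
    rw [hnorm, hσz, im_sliceEmb J.2, inv_smul_smul₀ hz, re_sliceEmb J.2]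
  have hscont : ContinuousAt s (sliceEmb J z) := by
    have hy : ContinuousAt (fun q : ℍ[ℝ] => σ * ‖q.im‖) (sliceEmb J z) :=
      (Quaternion.continuous_im.norm.const_mul σ).continuousAt
    have him : ContinuousAt (fun q : ℍ[ℝ] => q.im) (sliceEmb J z) :=
      Quaternion.continuous_im.continuousAt
    exact ((hy.inv₀ (by rwa [hnorm, hσz])).smul him).prodMk
      (continuous_mk_re_mul_norm_im σ).continuousAt
  have him : ∀ᶠ q in 𝓝 (sliceEmb J z), q.im ≠ 0 :=
    Quaternion.continuous_im.continuousAt.eventually_ne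
      (by rw [im_sliceEmb J.2]; exact smul_ne_zero hz (norm_ne_zero_iff.1 (by simp [J.2.2])))
  rw [(IsInducing.subtypeVal.prodMap IsInducing.id).closure_eq_preimage_closure_image]
  change ((J : ℍ[ℝ]), z) ∈ closure _
  rw [← hs]
  refine mem_closure_of_frequently_of_tendsto
    (((mem_closure_iff_frequently.1 hJz).and_eventually him).mono ?_) hscont
  rintro q ⟨hqU, hq⟩
  have hy : |σ * ‖q.im‖| = ‖q.im‖ := by rw [abs_mul, hσ, one_mul, abs_norm]
  refine ⟨(⟨_, inv_smul_im_mem_imagUnitSphere hy hq⟩, _), ?_, rfl⟩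
  have hy0 : σ * ‖q.im‖ ≠ 0 := abs_ne_zero.1 (hy.trans_ne (norm_ne_zero_iff.2 hq))
  simpa only [mem_ofPred_eq, sliceEmb_inv_smul_im q hy0]

theorem sliceSet_closure_subset_closure_im_ne_zero (hU : IsOpen U)
    (hsymm : IsAxiallySymmetric (closure U)) (hI : I ∈ imagUnitSphere) :
    sliceSet (closure U) I ⊆ closure (sliceSet (closure U) I ∩ {z | z.im ≠ 0}) := by
  intro z hz
  by_cases him : z.im = 0
  · have hzU : sliceEmb I z ∈ closure (U ∩ {q | q.im ≠ 0}) :=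
      closure_minimal (dense_im_ne_zero.open_subset_closure_inter hU) isClosed_closure
        (mem_sliceSet.1 hz)
    have hz' : (⟨(sliceEmb I z).re, 1 * ‖(sliceEmb I z).im‖⟩ : ℂ) = z := by
      rw [re_sliceEmb hI, norm_im_sliceEmb hI, him, abs_zero, mul_zero, ← him]
    rw [← hz']
    refine map_mem_closure (f := fun q : ℍ[ℝ] => (⟨q.re, 1 * ‖q.im‖⟩ : ℂ))
      (continuous_mk_re_mul_norm_im 1) hzU ?_
    rintro q ⟨hqU, hq⟩
    simp only [one_mul]
    refine ⟨?_, norm_ne_zero_iff.2 hq⟩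
    rw [sliceSet_eq_of_isAxiallySymmetric hsymm hI
      (inv_smul_im_mem_imagUnitSphere (abs_norm _) hq), mem_sliceSet,
      sliceEmb_inv_smul_im q (norm_ne_zero_iff.2 hq)]
    exact subset_closure hqU
  · exact subset_closure ⟨hz, him⟩

theorem dense_sliceSet_closure_subset_closure_sliceSet (hU : IsOpen U)
    (hsymm : IsAxiallySymmetric (closure U)) :
    Dense {I : imagUnitSphere | sliceSet (closure U) I ⊆ closure (sliceSet U I)} := by
  have : CompactSpace imagUnitSphere := isCompact_iff_compactSpace.1 isCompact_imagUnitSphere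
  obtain ⟨I₀, hI₀⟩ := imagUnitSphere_nonempty
  have hopen : IsOpen {p : imagUnitSphere × ℂ | sliceEmb p.1 p.2 ∈ U} :=
    hU.preimage (continuous_sliceEmb.comp (continuous_subtype_val.prodMap continuous_id))
  refine (dense_setOf_subset_closure_preimage_mk hopen
    (F := sliceSet (closure U) I₀ ∩ {z | z.im ≠ 0}) ?_).mono fun I hI => ?_
  · rintro ⟨J, z⟩ ⟨-, hz, him⟩
    rw [sliceSet_eq_of_isAxiallySymmetric hsymm hI₀ J.2] at hz
    exact mem_closure_setOf_sliceEmb_mem him (mem_sliceSet.1 hz)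
  · have hpre : Prod.mk I ⁻¹' {p : imagUnitSphere × ℂ | sliceEmb p.1 p.2 ∈ U} = sliceSet U I :=
      ext fun _ => mem_sliceSet.symm
    rw [mem_ofPred_eq, hpre] at hI
    rw [mem_ofPred_eq, sliceSet_eq_of_isAxiallySymmetric hsymm I.2 hI₀]
    exact (sliceSet_closure_subset_closure_im_ne_zero hU hsymm hI₀).trans
      (closure_minimal hI isClosed_closure)

end DenseSlices

section SliceRegularity

open Set Filter Topology

theorem deriv_comp_mk_left {E : Type*} [NormedAddCommGroup E] [NormedSpace ℝ E] {H : ℂ → E} {z : ℂ}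
    (hH : DifferentiableAt ℝ H z) :
    deriv (fun s : ℝ => H ⟨s, z.im⟩) z.re = fderiv ℝ H z 1 := by
  have hline : HasDerivAt (fun s : ℝ => (⟨s, z.im⟩ : ℂ)) 1 z.re := by
    simpa only [Complex.mk_eq_add_mul_I, Complex.ofRealCLM_apply, Complex.ofReal_one] using
      Complex.ofRealCLM.hasDerivAt.add_const (z.im * Complex.I)
  exact (hH.hasFDerivAt.comp_hasDerivAt z.re hline).deriv

theorem deriv_comp_mk_right {E : Type*} [NormedAddCommGroup E] [NormedSpace ℝ E] {H : ℂ → E}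
    {z : ℂ} (hH : DifferentiableAt ℝ H z) :
    deriv (fun t : ℝ => H ⟨z.re, t⟩) z.im = fderiv ℝ H z Complex.I := by
  have hline : HasDerivAt (fun t : ℝ => (⟨z.re, t⟩ : ℂ)) Complex.I z.im := by
    simpa only [Complex.mk_eq_add_mul_I, Complex.ofRealCLM_apply, Complex.ofReal_one, one_mul] using
      (Complex.ofRealCLM.hasDerivAt.mul_const Complex.I).const_add (z.re : ℂ)
  exact (hH.hasFDerivAt.comp_hasDerivAt z.im hline).deriv

/-- Left `J`-holomorphy at `z` of a quaternion valued function of a complex variable: its real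
derivative exists and intertwines multiplication by `i` with left multiplication by `J`. -/
def SliceHolomorphicAt (J : ℍ[ℝ]) (H : ℂ → ℍ[ℝ]) (z : ℂ) : Prop :=
  DifferentiableAt ℝ H z ∧ fderiv ℝ H z Complex.I = J * fderiv ℝ H z 1

variable {I J a : ℍ[ℝ]} {H G : ℂ → ℍ[ℝ]} {z : ℂ} {f : ℍ[ℝ] → ℍ[ℝ]} {U : Set ℍ[ℝ]}

theorem SliceHolomorphicAt.mul_left (hH : SliceHolomorphicAt I H z) (ha : J * a = a * I) :
    SliceHolomorphicAt J (fun w => a * H w) z := by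
  refine ⟨hH.1.const_mul a, ?_⟩
  simp only [fderiv_const_mul hH.1, _root_.smul_apply, smul_eq_mul, hH.2, ← mul_assoc, ha]

theorem SliceHolomorphicAt.add (hH : SliceHolomorphicAt J H z) (hG : SliceHolomorphicAt J G z) :
    SliceHolomorphicAt J (fun w => H w + G w) z := by
  refine ⟨hH.1.add hG.1, ?_⟩
  simp only [fderiv_fun_add hH.1 hG.1, _root_.add_apply, hH.2, hG.2, mul_add]

theorem SliceHolomorphicAt.const_smul (hH : SliceHolomorphicAt J H z) (c : ℝ) :
    SliceHolomorphicAt J (fun w => c • H w) z := by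
  refine ⟨hH.1.const_smul c, ?_⟩
  simp only [fderiv_fun_const_smul hH.1, _root_.smul_apply, hH.2, mul_smul_comm]

theorem SliceHolomorphicAt.sub (hH : SliceHolomorphicAt J H z) (hG : SliceHolomorphicAt J G z) :
    SliceHolomorphicAt J (fun w => H w - G w) z := by
  simpa only [neg_one_smul, ← sub_eq_add_neg] using hH.add (hG.const_smul (-1))

theorem IsSliceRegularOn.sliceHolomorphicAt (hf : IsSliceRegularOn f U) (hU : IsOpen U)
    (hI : I ∈ imagUnitSphere) (hz : z ∈ sliceSet U I) :
    SliceHolomorphicAt I (fun w => f (sliceEmb I w)) z := by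
  have hdiff : DifferentiableAt ℝ (fun w => f (sliceEmb I w)) z :=
    ((hf.1.differentiableAt (hU.mem_nhds (mem_sliceSet.1 hz))).comp z
      (sliceEmb I).differentiableAt)
  have hdbar := hf.2 I hI z.re z.im hz
  simp only [sliceDbar, slicePoint_eq_sliceEmb] at hdbar
  rw [deriv_comp_mk_left hdiff, deriv_comp_mk_right hdiff, smul_eq_zero_iff_right (by norm_num),
    ← neg_eq_iff_add_eq_zero] at hdbar
  refine ⟨hdiff, ?_⟩
  rw [← neg_neg (fderiv ℝ _ z 1), hdbar, mul_neg, ← mul_assoc, mul_self_of_mem_imagUnitSphere hI,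
    neg_one_mul, neg_neg]

/-- The complex coordinate in direction `a` on the quaternions, for the complex structure given by
left multiplication by `J`. -/
noncomputable def sliceCoord (J a : ℍ[ℝ]) : ℍ[ℝ] →L[ℝ] ℂ :=
  (innerSL ℝ a).smulRight 1 -
    ((innerSL ℝ a).comp (ContinuousLinearMap.mul ℝ ℍ[ℝ] J)).smulRight Complex.I

theorem sliceCoord_apply (J a q : ℍ[ℝ]) :
    sliceCoord J a q = (⟨inner ℝ a q, -inner ℝ a (J * q)⟩ : ℂ) := by
  apply Complex.ext <;> simp [sliceCoord]

theorem sliceCoord_mul (hJ : J ∈ imagUnitSphere) (a q : ℍ[ℝ]) :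
    sliceCoord J a (J * q) = Complex.I * sliceCoord J a q := by
  simp only [sliceCoord_apply]
  apply Complex.ext <;> simp [← mul_assoc, mul_self_of_mem_imagUnitSphere hJ]

theorem sum_sliceEmb_sliceCoord {ι : Type*} [Fintype ι] (hJ : J ∈ imagUnitSphere)
    (b : OrthonormalBasis ι ℝ ℍ[ℝ]) (q : ℍ[ℝ]) :
    ∑ i, sliceEmb J (sliceCoord J (b i) q) * b i = (2 : ℝ) • q := by
  have hterm (i : ι) : sliceEmb J (sliceCoord J (b i) q) * b i
      = inner ℝ (b i) q • b i - J * (inner ℝ (b i) (J * q) • b i) := by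
    rw [sliceEmb_apply, sliceCoord_apply, add_mul, Quaternion.coe_mul_eq_smul, smul_mul_assoc,
      neg_smul, mul_smul_comm, sub_eq_add_neg]
  simp only [hterm]
  rw [Finset.sum_sub_distrib, ← Finset.mul_sum, b.sum_repr', b.sum_repr', ← mul_assoc,
    mul_self_of_mem_imagUnitSphere hJ, neg_one_mul, sub_neg_eq_add, two_smul]

theorem SliceHolomorphicAt.differentiableAt_sliceCoord (hH : SliceHolomorphicAt J H z)
    (hJ : J ∈ imagUnitSphere) (a : ℍ[ℝ]) :
    DifferentiableAt ℂ (fun w => sliceCoord J a (H w)) z := by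
  have hderiv : HasFDerivAt (fun w => sliceCoord J a (H w))
      ((sliceCoord J a).comp (fderiv ℝ H z)) z :=
    (sliceCoord J a).hasFDerivAt.comp z hH.1.hasFDerivAt
  refine differentiableAt_complex_iff_differentiableAt_real.2 ⟨hderiv.differentiableAt, ?_⟩
  rw [hderiv.fderiv, ContinuousLinearMap.comp_apply, ContinuousLinearMap.comp_apply, hH.2,
    sliceCoord_mul hJ, smul_eq_mul]

theorem frequently_ofReal_nhdsNE (x : ℝ) {p : ℂ → Prop} (hp : ∀ t : ℝ, p t) :
    ∃ᶠ z in 𝓝[≠] (x : ℂ), p z := by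
  have hlim : Tendsto ((↑) : ℝ → ℂ) (𝓝[≠] x) (𝓝[≠] (x : ℂ)) :=
    tendsto_nhdsWithin_of_tendsto_nhds_of_eventually_within _
      (Complex.continuous_ofReal.continuousAt.mono_left nhdsWithin_le_nhds)
      (eventually_mem_nhdsWithin.mono fun _ ht => Complex.ofReal_injective.ne ht)
  exact hlim.frequently (Eventually.of_forall hp).frequently

theorem eqOn_zero_of_sliceHolomorphicAt (hJ : J ∈ imagUnitSphere) {W : Set ℂ} (hW : IsOpen W)
    (hconn : IsPreconnected W) {x : ℝ} (hx : (x : ℂ) ∈ W)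
    (hH : ∀ z ∈ W, SliceHolomorphicAt J H z) (hreal : ∀ t : ℝ, H t = 0) : EqOn H 0 W := by
  have hcoord (a : ℍ[ℝ]) : EqOn (fun w => sliceCoord J a (H w)) 0 W := by
    have hdiff : DifferentiableOn ℂ (fun w => sliceCoord J a (H w)) W := fun z hz =>
      ((hH z hz).differentiableAt_sliceCoord hJ a).differentiableWithinAt
    exact (hdiff.analyticOnNhd hW).eqOn_zero_of_preconnected_of_frequently_eq_zero hconn hx
      (frequently_ofReal_nhdsNE x fun t => by rw [hreal, map_zero])
  intro z hz
  have hre := congrArg Complex.re (hcoord (H z) hz)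
  simp only [sliceCoord_apply, Pi.zero_apply, Complex.zero_re] at hre
  exact inner_self_eq_zero.1 hre

end SliceRegularity

section RepresentationFormula

open Set

/-- The value at `x + J y` predicted by the representation formula for a slice regular function
with the values `a` at `x + I y` and `b` at `x - I y`. -/
noncomputable def sliceExtension (I J a b : ℍ[ℝ]) : ℍ[ℝ] :=
  (1 / 2 : ℝ) • ((1 - J * I) * a + (1 + J * I) * b)

variable {I J : ℍ[ℝ]} {U : Set ℍ[ℝ]} {x₀ : ℝ} {f : ℍ[ℝ] → ℍ[ℝ]} {z : ℂ}

theorem sliceExtension_self (I J a : ℍ[ℝ]) : sliceExtension I J a a = a := by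
  rw [sliceExtension, ← add_mul, sub_add_add_cancel, one_add_one_eq_two, two_mul, ← two_smul ℝ a,
    smul_smul, one_div_mul_cancel two_ne_zero, one_smul]

theorem sliceExtension_sub (I J a b a' b' : ℍ[ℝ]) :
    sliceExtension I J (a - a') (b - b') = sliceExtension I J a b - sliceExtension I J a' b' := by
  simp only [sliceExtension, ← smul_sub, mul_sub, add_sub_add_comm]

theorem sliceExtension_sum {ι : Type*} (s : Finset ι) (I J : ℍ[ℝ]) (a b : ι → ℍ[ℝ]) :
    sliceExtension I J (∑ i ∈ s, a i) (∑ i ∈ s, b i) = ∑ i ∈ s, sliceExtension I J (a i) (b i) := by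
  simp only [sliceExtension, Finset.mul_sum, ← Finset.sum_add_distrib, Finset.smul_sum]

theorem sliceExtension_mul_right (I J a b c : ℍ[ℝ]) :
    sliceExtension I J (a * c) (b * c) = sliceExtension I J a b * c := by
  simp only [sliceExtension, smul_mul_assoc, add_mul, mul_assoc]

theorem norm_sliceExtension_le (hI : I ∈ imagUnitSphere) (hJ : J ∈ imagUnitSphere)
    (a b : ℍ[ℝ]) : ‖sliceExtension I J a b‖ ≤ ‖a‖ + ‖b‖ := by
  have hJI : ‖J * I‖ = 1 := by rw [norm_mul, hJ.2, hI.2, one_mul]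
  have hsub : ‖1 - J * I‖ ≤ 2 := (norm_sub_le _ _).trans (by rw [norm_one, hJI]; norm_num)
  have hadd : ‖1 + J * I‖ ≤ 2 := (norm_add_le _ _).trans (by rw [norm_one, hJI]; norm_num)
  calc ‖sliceExtension I J a b‖
      = 1 / 2 * ‖(1 - J * I) * a + (1 + J * I) * b‖ := by
        rw [sliceExtension, norm_smul, Real.norm_of_nonneg (by norm_num)]
    _ ≤ 1 / 2 * (‖1 - J * I‖ * ‖a‖ + ‖1 + J * I‖ * ‖b‖) := by
        rw [← norm_mul, ← norm_mul]; gcongr; exact norm_add_le _ _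
    _ ≤ 1 / 2 * (2 * ‖a‖ + 2 * ‖b‖) := by gcongr
    _ = ‖a‖ + ‖b‖ := by ring

theorem sliceExtension_sliceEmb (hI : I ∈ imagUnitSphere) (J : ℍ[ℝ]) (z : ℂ) :
    sliceExtension I J (sliceEmb I z) (sliceEmb (-I) z) = sliceEmb J z := by
  have hJII : J * I * (z.im • I) = -(z.im • J) := by
    rw [mul_smul_comm, mul_assoc, mul_self_of_mem_imagUnitSphere hI, mul_neg_one, smul_neg]
  simp only [sliceExtension, sliceEmb_apply, smul_neg, mul_add, sub_mul, add_mul, one_mul, mul_neg,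
    hJII]
  module

theorem SliceHolomorphicAt.sliceExtension {H G : ℂ → ℍ[ℝ]} (hI : I ∈ imagUnitSphere)
    (hJ : J ∈ imagUnitSphere) (hH : SliceHolomorphicAt I H z)
    (hG : SliceHolomorphicAt (-I) G z) :
    SliceHolomorphicAt J (fun w => sliceExtension I J (H w) (G w)) z := by
  have hII : J * I * I = -J := by rw [mul_assoc, mul_self_of_mem_imagUnitSphere hI, mul_neg_one]
  have hJJ : J * (J * I) = -I := by
    rw [← mul_assoc, mul_self_of_mem_imagUnitSphere hJ, neg_one_mul]
  refine ((hH.mul_left ?_).add (hG.mul_left ?_)).const_smul _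
  · rw [mul_sub, sub_mul, hII, hJJ, mul_one, one_mul]; abel
  · rw [mul_add, add_mul, mul_neg, mul_neg, hII, hJJ, mul_one, one_mul]; abel

theorem subset_closure_inter {X : Type*} [TopologicalSpace X] {s t K : Set X} (hs : IsOpen s)
    (hsK : s ⊆ K) (hKs : K ⊆ closure s) (hKt : K ⊆ closure t) : K ⊆ closure (s ∩ t) :=
  hKs.trans <| closure_minimal (fun _ hx => hs.inter_closure ⟨hx, hKt (hsK hx)⟩) isClosed_closure

theorem sliceSet_closure_neg_subset_closure (h : sliceSet (closure U) I ⊆ closure (sliceSet U I)) :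
    sliceSet (closure U) (-I) ⊆ closure (sliceSet U (-I)) := by
  intro z hz
  rw [sliceSet_neg] at hz ⊢
  rw [← star_star z]
  exact map_mem_closure continuous_star (h hz) fun w hw => by rwa [mem_preimage, star_star]

theorem continuousOn_comp_sliceEmb (hf : ContinuousOn f U) (I : ℍ[ℝ]) :
    ContinuousOn (fun z => f (sliceEmb I z)) (sliceSet U I) :=
  hf.comp (sliceEmb I).continuous.continuousOn fun _ => mem_sliceSet.1

theorem ofReal_mem_sliceSet (hx₀ : (x₀ : ℍ[ℝ]) ∈ U) (I : ℍ[ℝ]) : (x₀ : ℂ) ∈ sliceSet U I := by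
  rwa [mem_sliceSet, sliceEmb_ofReal]

theorem eq_sliceExtension_of_subset_closure (hU : IsOpen U) (hx₀ : (x₀ : ℍ[ℝ]) ∈ U)
    (hstar : StarConvex ℝ (x₀ : ℍ[ℝ]) U) (hsymm : IsAxiallySymmetric (closure U))
    (hreg : IsSliceRegularOn f U) (hcont : ContinuousOn f (closure U)) (hI : I ∈ imagUnitSphere)
    (hJ : J ∈ imagUnitSphere) (hIcl : sliceSet (closure U) I ⊆ closure (sliceSet U I))
    (hJcl : sliceSet (closure U) J ⊆ closure (sliceSet U J)) (hz : z ∈ sliceSet (closure U) I) :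
    f (sliceEmb J z) = sliceExtension I J (f (sliceEmb I z)) (f (sliceEmb (-I) z)) := by
  have hnI := neg_mem_imagUnitSphere hI
  have hKJ := sliceSet_eq_of_isAxiallySymmetric hsymm hJ hI
  have hKn := sliceSet_eq_of_isAxiallySymmetric hsymm hnI hI
  have hKncl := sliceSet_closure_neg_subset_closure hIcl
  rw [hKn] at hKncl
  rw [hKJ] at hJcl
  set K := sliceSet (closure U) I
  set W := sliceSet U J ∩ (sliceSet U I ∩ sliceSet U (-I))
  have hWopen : IsOpen W :=
    (isOpen_sliceSet hU J).inter ((isOpen_sliceSet hU I).inter (isOpen_sliceSet hU (-I)))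
  have hWstar : StarConvex ℝ (x₀ : ℂ) W := (starConvex_sliceSet hstar J).inter
    ((starConvex_sliceSet hstar I).inter (starConvex_sliceSet hstar (-I)))
  have hxW : (x₀ : ℂ) ∈ W := ⟨ofReal_mem_sliceSet hx₀ J, ofReal_mem_sliceSet hx₀ I,
    ofReal_mem_sliceSet hx₀ (-I)⟩
  have hWK : W ⊆ K := inter_subset_right.trans
    (inter_subset_left.trans (sliceSet_subset_sliceSet_closure U I))
  have hKW : K ⊆ closure W :=
    subset_closure_inter (isOpen_sliceSet hU J) (hKJ ▸ sliceSet_subset_sliceSet_closure U J) hJcl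
      (subset_closure_inter (isOpen_sliceSet hU I) (sliceSet_subset_sliceSet_closure U I) hIcl
        hKncl)
  have hzero : EqOn (fun w => f (sliceEmb J w) -
      sliceExtension I J (f (sliceEmb I w)) (f (sliceEmb (-I) w))) 0 W :=
    eqOn_zero_of_sliceHolomorphicAt hJ hWopen
      (hWstar.isPathConnected hxW).isConnected.isPreconnected hxW
      (fun w ⟨hwJ, hwI, hwn⟩ => (hreg.sliceHolomorphicAt hU hJ hwJ).sub
        (.sliceExtension hI hJ (hreg.sliceHolomorphicAt hU hI hwI)
          (hreg.sliceHolomorphicAt hU hnI hwn)))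
      fun t => by simp only [sliceEmb_ofReal, sliceExtension_self, sub_self]
  have hcontJ := hKJ ▸ continuousOn_comp_sliceEmb hcont J
  have hcontn := hKn ▸ continuousOn_comp_sliceEmb hcont (-I)
  refine (EqOn.of_subset_closure (fun w hw => sub_eq_zero.1 (hzero hw)) hcontJ ?_ hWK hKW) hz
  exact ((continuousOn_const.mul (continuousOn_comp_sliceEmb hcont I)).add
    (continuousOn_const.mul hcontn)).const_smul (1 / 2 : ℝ)

theorem eq_sliceExtension (hU : IsOpen U) (hx₀ : (x₀ : ℍ[ℝ]) ∈ U)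
    (hstar : StarConvex ℝ (x₀ : ℍ[ℝ]) U) (hsymm : IsAxiallySymmetric (closure U))
    (hreg : IsSliceRegularOn f U) (hcont : ContinuousOn f (closure U)) (hI : I ∈ imagUnitSphere)
    (hJ : J ∈ imagUnitSphere) (hIcl : sliceSet (closure U) I ⊆ closure (sliceSet U I))
    (hz : z ∈ sliceSet (closure U) I) :
    f (sliceEmb J z) = sliceExtension I J (f (sliceEmb I z)) (f (sliceEmb (-I) z)) := by
  have hcontJ : Continuous fun J : imagUnitSphere => f (sliceEmb J z) := by
    refine hcont.comp_continuous
      (continuous_sliceEmb.comp (continuous_subtype_val.prodMk continuous_const)) fun J => ?_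
    exact mem_sliceSet.1 (sliceSet_eq_of_isAxiallySymmetric hsymm hI J.2 ▸ hz)
  have hcontExt : Continuous fun J : imagUnitSphere =>
      sliceExtension I J (f (sliceEmb I z)) (f (sliceEmb (-I) z)) := by
    unfold sliceExtension
    fun_prop
  exact congrFun (hcontJ.ext_on (dense_sliceSet_closure_subset_closure_sliceSet hU hsymm) hcontExt
    fun J hJcl => eq_sliceExtension_of_subset_closure hU hx₀ hstar hsymm hreg hcont hI J.2 hIcl
      hJcl hz) ⟨J, hJ⟩

end RepresentationFormula

section RightPolynomials

open Set

variable {I J : ℍ[ℝ]} {P f : ℍ[ℝ] → ℍ[ℝ]} {ε : ℝ}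

theorem IsRightPolynomial.add_const (hP : IsRightPolynomial P) (c : ℍ[ℝ]) :
    IsRightPolynomial fun q => P q + c := by
  obtain ⟨n, a, ha⟩ := hP
  refine ⟨n, fun k => a k + if k = 0 then c else 0, fun q => ?_⟩
  simp only [ha, mul_add, Finset.sum_add_distrib, mul_ite, mul_zero, Finset.sum_ite_eq',
    Finset.mem_range, Nat.succ_pos, if_true, pow_zero, one_mul]

theorem IsRightPolynomial.eq_sliceExtension (hP : IsRightPolynomial P) (hI : I ∈ imagUnitSphere)
    (hJ : J ∈ imagUnitSphere) (z : ℂ) :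
    P (sliceEmb J z) = sliceExtension I J (P (sliceEmb I z)) (P (sliceEmb (-I) z)) := by
  obtain ⟨n, a, ha⟩ := hP
  simp only [ha, sliceExtension_sum, sliceExtension_mul_right, ← sliceEmb_pow hI,
    ← sliceEmb_pow (neg_mem_imagUnitSphere hI), sliceExtension_sliceEmb hI, ← sliceEmb_pow hJ]

theorem exists_isRightPolynomial_sliceEmb_eq {ι : Type*} [Fintype ι] (hI : I ∈ imagUnitSphere)
    (p : ι → Polynomial ℂ) (b : ι → ℍ[ℝ]) :
    ∃ P, IsRightPolynomial P ∧ ∀ z, P (sliceEmb I z) = ∑ i, sliceEmb I ((p i).eval z) * b i := by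
  set n := Finset.univ.sup fun i => (p i).natDegree
  have hdeg (i : ι) : (p i).natDegree < n + 1 :=
    Nat.lt_succ_of_le (Finset.le_sup (f := fun i => (p i).natDegree) (Finset.mem_univ i))
  refine ⟨_, ⟨n, fun k => ∑ i, sliceEmb I ((p i).coeff k) * b i, fun _ => rfl⟩, fun z => ?_⟩
  have heval (i : ι) : sliceEmb I ((p i).eval z) =
      ∑ k ∈ Finset.range (n + 1), sliceEmb I z ^ k * sliceEmb I ((p i).coeff k) := by
    rw [Polynomial.eval_eq_sum_range' (hdeg i), map_sum]
    exact Finset.sum_congr rfl fun k _ => by rw [mul_comm, sliceEmb_mul hI, sliceEmb_pow hI]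
  simp only [heval, Finset.mul_sum, Finset.sum_mul, mul_assoc]
  exact Finset.sum_comm

theorem exists_isRightPolynomial_norm_sub_lt_of_polyApprox (hI : I ∈ imagUnitSphere) {K : Set ℂ}
    {H : ℂ → ℍ[ℝ]} (hH : ∀ a, PolyApprox K fun z => sliceCoord I a (H z)) (hε : 0 < ε) :
    ∃ P, IsRightPolynomial P ∧ ∀ z ∈ K, ‖H z - P (sliceEmb I z)‖ < ε := by
  set b := stdOrthonormalBasis ℝ ℍ[ℝ]
  choose p hp using fun i => hH (b i) (ε / 4) (by positivity)
  obtain ⟨P, hP, hPI⟩ :=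
    exists_isRightPolynomial_sliceEmb_eq hI p fun i => (1 / 2 : ℝ) • b i
  refine ⟨P, hP, fun z hz => ?_⟩
  have hsum : H z - P (sliceEmb I z) =
      ∑ i, sliceEmb I (sliceCoord I (b i) (H z) - (p i).eval z) * ((1 / 2 : ℝ) • b i) := by
    simp only [hPI, map_sub, sub_mul, mul_smul_comm, Finset.sum_sub_distrib, ← Finset.smul_sum,
      sum_sliceEmb_sliceCoord hI b, smul_smul, smul_sub, one_div_mul_cancel (two_ne_zero' ℝ),
      one_smul]
  have hterm (i) : ‖sliceEmb I (sliceCoord I (b i) (H z) - (p i).eval z) * ((1 / 2 : ℝ) • b i)‖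
      ≤ ε / 8 := by
    rw [norm_mul, norm_sliceEmb hI, norm_smul, b.norm_eq_one, Real.norm_of_nonneg (by norm_num)]
    linarith [hp i z hz]
  calc ‖H z - P (sliceEmb I z)‖
      ≤ ∑ i : Fin (Module.finrank ℝ ℍ[ℝ]), ε / 8 :=
        hsum ▸ norm_sum_le_of_le _ fun i _ => hterm i
    _ = ε / 2 := by
        rw [Finset.sum_const, Finset.card_univ, Fintype.card_fin, Quaternion.finrank_eq_four,
          nsmul_eq_mul]
        ring
    _ < ε := half_lt_self hε

theorem exists_isRightPolynomial_eq_of_approx {S : Set ℍ[ℝ]}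
    (happrox : ∀ ε > 0, ∃ P, IsRightPolynomial P ∧ ∀ q ∈ S, ‖f q - P q‖ < ε) {α : ℍ[ℝ]}
    (hα : α ∈ S) (hε : 0 < ε) :
    ∃ P, IsRightPolynomial P ∧ (∀ q ∈ S, ‖f q - P q‖ < ε) ∧ P α = f α := by
  obtain ⟨P, hP, hPf⟩ := happrox (ε / 2) (half_pos hε)
  refine ⟨_, hP.add_const (f α - P α), fun q hq => ?_, add_sub_cancel _ _⟩
  calc ‖f q - (P q + (f α - P α))‖ = ‖(f q - P q) - (f α - P α)‖ := by rw [sub_sub]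
    _ ≤ ‖f q - P q‖ + ‖f α - P α‖ := norm_sub_le _ _
    _ < ε / 2 + ε / 2 := add_lt_add (hPf q hq) (hPf α hα)
    _ = ε := add_halves ε

end RightPolynomials

section Approximation

open Set

variable {I : ℍ[ℝ]} {Ω : Set ℍ[ℝ]} {x₀ : ℝ} {f P : ℍ[ℝ] → ℍ[ℝ]} {ε : ℝ}

theorem polyApprox_sliceCoord_comp_sliceEmb (hopen : IsOpen Ω) (hbdd : Bornology.IsBounded Ω)
    (hstar : StarConvex ℝ (x₀ : ℍ[ℝ]) Ω) (hreg : IsSliceRegularOn f Ω)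
    (hcont : ContinuousOn f (closure Ω)) (hI : I ∈ imagUnitSphere)
    (hIcl : sliceSet (closure Ω) I ⊆ closure (sliceSet Ω I))
    (hint : interior (closure (sliceSet Ω I)) ⊆ sliceSet Ω I) (a : ℍ[ℝ]) :
    PolyApprox (sliceSet (closure Ω) I) fun z => sliceCoord I a (f (sliceEmb I z)) := by
  have hcl : StarConvex ℝ (x₀ : ℍ[ℝ]) (closure Ω) := fun q hq s t hs ht hst =>
    map_mem_closure (f := fun q => s • (x₀ : ℍ[ℝ]) + t • q) (by fun_prop) hq
      fun p hp => hstar hp hs ht hst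
  refine PolyApprox.of_continuousOn_of_starConvex (isCompact_sliceSet hbdd.isCompact_closure hI)
    (starConvex_sliceSet hcl I)
    ((sliceCoord I a).continuous.comp_continuousOn (continuousOn_comp_sliceEmb hcont I))
    fun z hz => ?_
  have hhol := hreg.sliceHolomorphicAt hopen hI (hint (interior_mono hIcl hz))
  exact (hhol.differentiableAt_sliceCoord hI a).differentiableWithinAt

theorem norm_sub_lt_of_forall_sliceSet (hopen : IsOpen Ω) (hx₀ : (x₀ : ℍ[ℝ]) ∈ Ω)
    (hstar : StarConvex ℝ (x₀ : ℍ[ℝ]) Ω) (hsymm : IsAxiallySymmetric (closure Ω))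
    (hreg : IsSliceRegularOn f Ω) (hcont : ContinuousOn f (closure Ω)) (hI : I ∈ imagUnitSphere)
    (hIcl : sliceSet (closure Ω) I ⊆ closure (sliceSet Ω I)) (hP : IsRightPolynomial P)
    (hPf : ∀ z ∈ sliceSet (closure Ω) I, ‖f (sliceEmb I z) - P (sliceEmb I z)‖ < ε / 2)
    {q : ℍ[ℝ]} (hq : q ∈ closure Ω) : ‖f q - P q‖ < ε := by
  obtain ⟨J, hJ, z, rfl⟩ := exists_sliceEmb_eq q
  have hz : z ∈ sliceSet (closure Ω) I := by
    rwa [sliceSet_eq_of_isAxiallySymmetric hsymm hI hJ, mem_sliceSet]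
  have hz' : star z ∈ sliceSet (closure Ω) I := by
    rwa [← mem_preimage, ← sliceSet_neg,
      sliceSet_eq_of_isAxiallySymmetric hsymm (neg_mem_imagUnitSphere hI) hI]
  rw [eq_sliceExtension hopen hx₀ hstar hsymm hreg hcont hI hJ hIcl hz, hP.eq_sliceExtension hI hJ,
    ← sliceExtension_sub, sliceEmb_neg]
  calc ‖sliceExtension I J (f (sliceEmb I z) - P (sliceEmb I z))
        (f (sliceEmb I (star z)) - P (sliceEmb I (star z)))‖
      ≤ ‖f (sliceEmb I z) - P (sliceEmb I z)‖ +
          ‖f (sliceEmb I (star z)) - P (sliceEmb I (star z))‖ := norm_sliceExtension_le hI hJ _ _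
    _ < ε / 2 + ε / 2 := add_lt_add (hPf z hz) (hPf _ hz')
    _ = ε := add_halves ε

theorem exists_isRightPolynomial_norm_sub_lt (hopen : IsOpen Ω) (hbdd : Bornology.IsBounded Ω)
    (hint : ∀ I ∈ imagUnitSphere, interior (closure (sliceSet Ω I)) ⊆ sliceSet Ω I)
    (hx₀ : (x₀ : ℍ[ℝ]) ∈ Ω) (hstar : StarConvex ℝ (x₀ : ℍ[ℝ]) Ω)
    (hsymm : IsAxiallySymmetric (closure Ω)) (hreg : IsSliceRegularOn f Ω)
    (hcont : ContinuousOn f (closure Ω)) (hε : 0 < ε) :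
    ∃ P, IsRightPolynomial P ∧ ∀ q ∈ closure Ω, ‖f q - P q‖ < ε := by
  have : Nonempty imagUnitSphere := imagUnitSphere_nonempty.to_subtype
  obtain ⟨⟨I, hI⟩, hIcl⟩ :=
    (dense_sliceSet_closure_subset_closure_sliceSet hopen hsymm).nonempty
  obtain ⟨P, hP, hPf⟩ := exists_isRightPolynomial_norm_sub_lt_of_polyApprox hI
    (polyApprox_sliceCoord_comp_sliceEmb hopen hbdd hstar hreg hcont hI hIcl (hint I hI))
    (half_pos hε)
  exact ⟨P, hP, fun q hq => norm_sub_lt_of_forall_sliceSet hopen hx₀ hstar hsymm hreg hcont hI hIcl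
    hP hPf hq⟩

end Approximation

theorem mainTheorem9_general
    (Ω : Set ℍ[ℝ]) (hopen : IsOpen Ω) (hbdd : Bornology.IsBounded Ω)
    (hint : ∀ I ∈ imagUnitSphere, interior (closure (sliceSet Ω I)) ⊆ sliceSet Ω I)
    (x₀ : ℝ) (hstar : StarConvex ℝ (x₀ : ℍ[ℝ]) Ω)
    (hsymm : IsAxiallySymmetric (closure Ω))
    (α : ℍ[ℝ]) (hα : α ∈ closure Ω)
    (f : ℍ[ℝ] → ℍ[ℝ]) (hreg : IsSliceRegularOn f Ω) (hcont : ContinuousOn f (closure Ω)) :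
    ∀ ε : ℝ, 0 < ε → ∃ P : ℍ[ℝ] → ℍ[ℝ], IsRightPolynomial P ∧
      (∀ q ∈ closure Ω, ‖f q - P q‖ < ε) ∧ P α = f α := by
  have hx₀ : (x₀ : ℍ[ℝ]) ∈ Ω := hstar.mem (closure_nonempty_iff.1 ⟨α, hα⟩)
  exact fun ε hε => exists_isRightPolynomial_eq_of_approx
    (fun _ => exists_isRightPolynomial_norm_sub_lt hopen hbdd hint hx₀ hstar hsymm hreg hcont) hα hε

theorem mainTheorem9
    (Ω : Set ℍ[ℝ]) (hopen : IsOpen Ω) (hconn : IsConnected Ω)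
    (hbdd : Bornology.IsBounded Ω)
    (hjordan : ∀ I ∈ imagUnitSphere, IsBoundedJordanRegion (sliceSet Ω I))
    (x₀ : ℝ) (hstar : StarConvex ℝ (x₀ : ℍ[ℝ]) Ω)
    (hsymm : IsAxiallySymmetric (closure Ω))
    (hcompl : IsConnected (extendedCompl (closure Ω)))
    (hslice : ∀ I ∈ imagUnitSphere, IsConnected (extendedCompl (sliceSet (closure Ω) I)))
    (α : ℍ[ℝ]) (hα : α ∈ closure Ω)
    (f : ℍ[ℝ] → ℍ[ℝ]) (hreg : IsSliceRegularOn f Ω) (hcont : ContinuousOn f (closure Ω)) :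
    ∀ ε : ℝ, 0 < ε → ∃ P : ℍ[ℝ] → ℍ[ℝ], IsRightPolynomial P ∧
      (∀ q ∈ closure Ω, ‖f q - P q‖ < ε) ∧ P α = f α := by
  exact mainTheorem9_general Ω hopen hbdd
    (fun I hI => (hjordan I hI).interior_closure_subset
      (ofReal_mem_sliceSet (hstar.mem hconn.nonempty) I) (starConvex_sliceSet hstar I))
    x₀ hstar hsymm α hα f hreg hcont
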